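/- **Setting.** For integers $d,r\ge 1$ and reals $\mu,\beta$, let $M^\star\in\mathbb R^{d\times d}$ be a symmetric positive semidefinite matrix of rank exactly $r$, with largest singular value $\sigma_1^\star$, $r$-th singular value $\sigma_r^\star>0$ and condition number $\kappa^\star=\sigma_1^\star/\sigma_r^\star$. Assume $M^\star$ is $\mu$-incoherent: for its rank-$r$ SVD $M^\star=XDY^\top$ one has $\|e_i^\top X\|\le\sqrt{\mu r/d}$ and $\|e_i^\top Y\|\le\sqrt{\mu r/d}$ for all $i$. Let $\mathcal S_\beta$ be the set of all $S\in\mathbb R^{d\times d}$ such that each row and each column of $S$ has at most $\beta d$ non-zero entries and $\max_{i,j}|S_{ij}|\le 2\mu r\sigma_1^\star/d$. Let $S^\star\in\mathcal S_\alpha$, $M_o=M^\star+S^\star$, and for $U\in\mathbb R^{d\times r}$ put $$f(U)=\min_{S\in\mathcal S_{\gamma\alpha}}\tfrac12\|UU^\top+S-M_o\|_F^2 .$$ A function $f:\mathbb R^{d\times r}\to\mathbb R$ (Frobenius norm) is called $(\theta,\eta,\zeta)$-pseudo strict saddle if for every $x$ at least one of the following holds: (i) $f$ is differentiable at $x$ and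 $\|\nabla f(x)\|_F\ge\theta$; (ii) there is a smooth function $g_x$ with $g_x(y)\ge f(y)$ for all $y$, $g_x(x)=f(x)$ and $\lambda_{\min}(\nabla^2 g_x(x))\le-\eta$; (iii) there is a local minimum $y$ of $f$ with $\|x-y\|_F\le\zeta$. **Theorem 4.3.** There are absolute constants $c,c_1,c_2,c_3>0$ such that for all $d,r,\mu,\alpha,\gamma,M^\star,S^\star$ as above with $\gamma>c$ and $\gamma\alpha\cdot\mu r\cdot(\kappa^\star)^5\le 1/c$: 1. every local minimum $U$ of $f$ satisfies $UU^\top=M^\star$; 2. for every $\varepsilon$ with $0<\varepsilon\le c_3\,\sigma_r^\star\sqrt{\sigma_r^\star/d}$, the function $f$ is $\left(\varepsilon,\;c_1\sigma_r^\star,\;c_2\,\varepsilon\sqrt{\kappa^\star}/\sigma_r^\star\right)$-pseudo strict saddle. -/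

import Mathlib

open scoped Matrix Matrix.Norms.Frobenius ContDiff

noncomputable section

namespace RobustPCA

/-! Throughout, spaces of real matrices carry the Frobenius norm. -/

/-- The `k`-th largest singular value of a real square matrix, counted from `k = 1`, with
multiplicity.  (Mathlib counts singular values from `0`.) -/
def sigma {d : ℕ} (M : Matrix (Fin d) (Fin d) ℝ) (k : ℕ) : ℝ :=
  (Matrix.toEuclideanLin M).singularValues (k - 1)

/-- The condition number `σ₁ / σᵣ` of a matrix of rank `r`. -/
def condNumber {d : ℕ} (M : Matrix (Fin d) (Fin d) ℝ) (r : ℕ) : ℝ :=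
  sigma M 1 / sigma M r

/-- `M` has a rank-`r` singular value decomposition `X D Yᵀ` (orthonormal columns, `r` positive
singular values) all of whose rows satisfy `‖eᵢᵀ X‖ ≤ √(μ r / d)` and `‖eⱼᵀ Y‖ ≤ √(μ r / d)`.
The row norms do not depend on the decomposition: `X Xᵀ` and `Y Yᵀ` are the orthogonal projections
onto the column space and the row space of `M`. -/
def IsIncoherent {d : ℕ} (μ : ℝ) (r : ℕ) (M : Matrix (Fin d) (Fin d) ℝ) : Prop :=
  ∃ (X Y : Matrix (Fin d) (Fin r) ℝ) (s : Fin r → ℝ),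
    Xᵀ * X = 1 ∧ Yᵀ * Y = 1 ∧ (∀ k, 0 < s k) ∧ M = X * Matrix.diagonal s * Yᵀ ∧
    (∀ i, ‖WithLp.toLp 2 (X i)‖ ≤ √(μ * r / d)) ∧
    (∀ j, ‖WithLp.toLp 2 (Y j)‖ ≤ √(μ * r / d))

/-- The `d × d` matrices with at most a fraction `β` of non-zero entries in each row and in each
column, and with all entries bounded by `b` in absolute value. -/
def sparseSet (d : ℕ) (β b : ℝ) : Set (Matrix (Fin d) (Fin d) ℝ) :=
  {S | (∀ i, ((Finset.univ.filter fun j => S i j ≠ 0).card : ℝ) ≤ β * d) ∧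
       (∀ j, ((Finset.univ.filter fun i => S i j ≠ 0).card : ℝ) ≤ β * d) ∧
       (∀ i j, |S i j| ≤ b)}

/-- The objective `f(U) = min_{S ∈ 𝒮} ½ ‖U Uᵀ + S - Mₒ‖_F²`. -/
def objective {d r : ℕ} (𝒮 : Set (Matrix (Fin d) (Fin d) ℝ)) (Mo : Matrix (Fin d) (Fin d) ℝ)
    (U : Matrix (Fin d) (Fin r) ℝ) : ℝ :=
  sInf ((fun S => 1 / 2 * ‖U * Uᵀ + S - Mo‖ ^ 2) '' 𝒮)

theorem isCompact_sparseSet (d : ℕ) (β b : ℝ) : IsCompact (sparseSet d β b) := by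
  classical
  set box : Set (Matrix (Fin d) (Fin d) ℝ) :=
    Set.pi Set.univ fun _ => Set.pi Set.univ fun _ => Set.Icc (-b) b with hbox
  have hboxc : IsCompact box :=
    isCompact_univ_pi fun _ => isCompact_univ_pi fun _ => isCompact_Icc
  set good : Set (Finset (Fin d × Fin d)) := {T |
    (∀ i, ((Finset.univ.filter fun j => (i, j) ∈ T).card : ℝ) ≤ β * d) ∧
    (∀ j, ((Finset.univ.filter fun i => (i, j) ∈ T).card : ℝ) ≤ β * d)} with hgood
  have key : sparseSet d β b = ⋃ T ∈ good, box ∩ {S | ∀ i j, (i, j) ∉ T → S i j = 0} := by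
    ext S
    simp only [Set.mem_iUnion, exists_prop]
    constructor
    · rintro ⟨h1, h2, h3⟩
      refine ⟨Finset.univ.filter fun p => S p.1 p.2 ≠ 0, ⟨?_, ?_⟩, ?_, ?_⟩
      · intro i; simpa using h1 i
      · intro j; simpa using h2 j
      · intro i _ j _; exact abs_le.1 (h3 i j)
      · intro i j hij; simpa using hij
    · rintro ⟨T, ⟨h1, h2⟩, h3, h4⟩
      refine ⟨fun i => le_trans ?_ (h1 i), fun j => le_trans ?_ (h2 j), fun i j => ?_⟩
      · exact_mod_cast Finset.card_le_card fun j hj => by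
          simp only [Finset.mem_filter, Finset.mem_univ, true_and] at hj ⊢
          by_contra hc
          exact hj (h4 i j hc)
      · exact_mod_cast Finset.card_le_card fun i hi => by
          simp only [Finset.mem_filter, Finset.mem_univ, true_and] at hi ⊢
          by_contra hc
          exact hi (h4 i j hc)
      · exact abs_le.2 (h3 i trivial j trivial)
  rw [key]
  refine (Set.toFinite good).isCompact_biUnion fun T _ => hboxc.inter_right ?_
  simp only [Set.ofPred_forall]
  exact isClosed_iInter fun i => isClosed_iInter fun j => isClosed_iInter fun _ =>
    isClosed_eq (by fun_prop) continuous_const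

/-- The infimum that defines the objective is a minimum. -/
theorem isLeast_objective {d r : ℕ} {β b : ℝ} (h : (sparseSet d β b).Nonempty)
    (Mo : Matrix (Fin d) (Fin d) ℝ) (U : Matrix (Fin d) (Fin r) ℝ) :
    IsLeast ((fun S => 1 / 2 * ‖U * Uᵀ + S - Mo‖ ^ 2) '' sparseSet d β b)
      (objective (sparseSet d β b) Mo U) :=
  ((isCompact_sparseSet d β b).image (by fun_prop)).isLeast_sInf (h.image _)

/-- `λ_min(∇² g (x)) ≤ b`: the Hessian quadratic form of `g` at `x` takes a value at most
`b ‖v‖²` at some non-zero `v` (in a finite-dimensional Euclidean space, this says by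
the Rayleigh quotient characterization that the least eigenvalue of the Hessian is at most `b`). -/
def HessianMinEigLE {E : Type*} [NormedAddCommGroup E] [NormedSpace ℝ E]
    (g : E → ℝ) (x : E) (b : ℝ) : Prop :=
  ∃ v : E, v ≠ 0 ∧ fderiv ℝ (fderiv ℝ g) x v v ≤ b * ‖v‖ ^ 2

/-- `(θ, η, ζ)`-pseudo strict saddle, for a function that need not be differentiable everywhere:
at every point `x`, the gradient exists and has norm at least `θ`, or some smooth upper bound
of `f` that agrees with `f` at `x` has a Hessian at `x` with least eigenvalue at most `-η`, or `x`
is within distance `ζ` of a local minimum of `f`.  The norm of the gradient is the norm of the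
derivative as a linear functional. -/
def IsPseudoStrictSaddle {E : Type*} [NormedAddCommGroup E] [NormedSpace ℝ E]
    (f : E → ℝ) (θ η ζ : ℝ) : Prop :=
  ∀ x : E,
    (DifferentiableAt ℝ f x ∧ θ ≤ ‖fderiv ℝ f x‖) ∨
    (∃ g : E → ℝ, ContDiff ℝ ∞ g ∧ (∀ y, f y ≤ g y) ∧ g x = f x ∧ HessianMinEigLE g x (-η)) ∨
    (∃ y : E, IsLocalMin f y ∧ ‖x - y‖ ≤ ζ)

end RobustPCA

end

/-!
Fix a sparse matrix `S` and put `E = S - S⋆`, `D = U Uᵀ - M⋆`. The loss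
`g_S(U) = ½ ‖U Uᵀ + S - Mₒ‖²` is a smooth majorant of the objective `f`, and touches it at `U` when
`S` is optimal for `U`. Everything is read off from such majorants.

*Nonsmooth points.* If two optimal `S` give different derivatives at `U`, then `f` has a concave
kink there, and a smooth majorant with arbitrarily negative curvature exists
(`exists_majorant_of_fderiv_ne`). If all optimal `S` give the same derivative, then `f` is
differentiable by Danskin's theorem (`hasFDerivAt_of_isLeast_family`). It therefore suffices to
show that an approximate second-order critical point of `g_S`, with `S` optimal, is close to a
factor of `M⋆`, which is a global minimum of `f` (`isPseudoStrictSaddle_of_family`).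

*The unperturbed landscape.* Choose the factor `V` of `M⋆` closest to `U`, so that `Uᵀ V` is
symmetric positive semidefinite (`exists_aligned_factor`), and let `Δ = U - V`. Then
`‖Δ Δᵀ‖² ≤ 2 ‖D‖²` and `‖D‖² ≥ ⅘ σᵣ ‖Δ‖²`. Since `U Δᵀ + Δ Uᵀ = D + Δ Δᵀ`,
`∇²g_S(U)[Δ, Δ] - 4 ⟨∇g_S(U), Δ⟩ = ‖Δ Δᵀ‖² - 3 ‖D‖² - 4 ⟨E, D⟩ - 2 ⟨E, Δ Δᵀ⟩`,
so that without the two terms in `E` the curvature along `Δ` would be at most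
`4 ⟨∇g_S(U), Δ⟩ - ‖D‖²`.

*The perturbation.* Optimality of `S` gives `‖E‖² + 2 ⟨E, D⟩ ≤ 0`, so `E` is controlled by the
entries of `D` on the support of `E`, and the two terms are small if the rows of `U` and `V` are
(`sparse_error_le`). For `V` this is the incoherence of `M⋆`. For `U` it comes in two steps: almost
nonnegative curvature in the directions `v wᵀ` forces `‖U w‖² ≥ ¼ σᵣ ‖w‖²`
(`mulVec_dotProduct_ge_of_curvature`), and then an almost vanishing derivative in the direction
`eᵢ Uᵢᵀ` bounds the row `Uᵢ` by the `i`-th rows of `M⋆` and `E` (`row_dotProduct_le_of_slope`). The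
two parts are combined in `norm_sub_le_of_approx_critical`.
-/

noncomputable section

namespace RobustPCA

/-! ### The Frobenius inner product -/

section Frobenius

variable {l m n : Type*} [Fintype l] [Fintype m] [Fintype n]

/-- The Frobenius inner product `tr (Aᵀ B)` of two real matrices. -/
def frobInner (A B : Matrix m n ℝ) : ℝ := (Aᵀ * B).trace

theorem frobInner_eq_sum (A B : Matrix m n ℝ) : frobInner A B = ∑ i, ∑ j, A i j * B i j := by
  rw [frobInner, Matrix.trace, Finset.sum_comm]
  simp [Matrix.mul_apply]

theorem frobInner_comm (A B : Matrix m n ℝ) : frobInner A B = frobInner B A := by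
  simp_rw [frobInner_eq_sum, mul_comm]

theorem frobInner_add_left (A B C : Matrix m n ℝ) :
    frobInner (A + B) C = frobInner A C + frobInner B C := by
  simp [frobInner, Matrix.add_mul]

theorem frobInner_sub_left (A B C : Matrix m n ℝ) :
    frobInner (A - B) C = frobInner A C - frobInner B C := by
  simp [frobInner, Matrix.sub_mul]

theorem frobInner_smul_left (t : ℝ) (A B : Matrix m n ℝ) :
    frobInner (t • A) B = t * frobInner A B := by
  simp [frobInner]

theorem frobInner_add_right (A B C : Matrix m n ℝ) :
    frobInner A (B + C) = frobInner A B + frobInner A C := by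
  simp [frobInner, Matrix.mul_add]

theorem frobInner_sub_right (A B C : Matrix m n ℝ) :
    frobInner A (B - C) = frobInner A B - frobInner A C := by
  simp [frobInner, Matrix.mul_sub]

theorem frobInner_smul_right (t : ℝ) (A B : Matrix m n ℝ) :
    frobInner A (t • B) = t * frobInner A B := by
  simp [frobInner]

theorem frobInner_self (A : Matrix m n ℝ) : frobInner A A = ‖A‖ ^ 2 := by
  rw [frobInner_eq_sum, Matrix.frobenius_norm_def, ← Real.sqrt_eq_rpow, Real.sq_sqrt]
  · simp [sq]
  · positivity

theorem frobInner_self_nonneg (A : Matrix m n ℝ) : 0 ≤ frobInner A A := by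
  rw [frobInner_self]; positivity

theorem frobInner_transpose (A B : Matrix m n ℝ) : frobInner Aᵀ Bᵀ = frobInner A B := by
  rw [frobInner_eq_sum, frobInner_eq_sum, Finset.sum_comm]
  rfl

/-- Inner products of Gram-type products: `⟨P Rᵀ, S Tᵀ⟩ = ⟨Sᵀ P, Tᵀ R⟩`. -/
theorem frobInner_mul_transpose {k : Type*} [Fintype k] (P : Matrix m l ℝ) (R : Matrix n l ℝ)
    (S : Matrix m k ℝ) (T : Matrix n k ℝ) :
    frobInner (P * Rᵀ) (S * Tᵀ) = frobInner (Sᵀ * P) (Tᵀ * R) := by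
  simp only [frobInner, Matrix.transpose_mul, Matrix.transpose_transpose]
  rw [Matrix.mul_assoc, Matrix.trace_mul_comm]
  simp only [Matrix.mul_assoc]

end Frobenius

/-! ### Aligned factors -/

section Alignment

variable {d r : ℕ}

theorem dotProduct_self_pos {ι : Type*} [Fintype ι] {w : ι → ℝ} (hw : w ≠ 0) : 0 < w ⬝ᵥ w := by
  have h := Matrix.dotProduct_star_self_pos_iff (v := w)
  simpa using h.2 hw

/-- The Householder reflection in the hyperplane orthogonal to `w`. -/
def reflection (w : Fin r → ℝ) : Matrix (Fin r) (Fin r) ℝ :=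
  1 - (2 / (w ⬝ᵥ w)) • Matrix.vecMulVec w w

theorem reflection_mul_transpose {w : Fin r → ℝ} (hw : w ≠ 0) :
    reflection w * (reflection w)ᵀ = 1 := by
  have h := (dotProduct_self_pos hw).ne'
  have ht : (reflection w)ᵀ = reflection w := by
    simp [reflection, Matrix.transpose_vecMulVec]
  rw [ht]
  simp only [reflection, Matrix.sub_mul, Matrix.mul_sub, Matrix.smul_mul, Matrix.mul_smul,
    Matrix.vecMulVec_mul_vecMulVec, Matrix.one_mul, Matrix.mul_one]
  ext i j
  simp [Matrix.vecMulVec_apply]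
  field_simp
  ring

theorem trace_mul_reflection (B : Matrix (Fin r) (Fin r) ℝ) (w : Fin r → ℝ) :
    (B * reflection w).trace = B.trace - 2 / (w ⬝ᵥ w) * (w ⬝ᵥ B *ᵥ w) := by
  simp [reflection, Matrix.mul_sub, Matrix.mul_vecMulVec, Matrix.trace_vecMulVec,
    dotProduct_comm w]

theorem dotProduct_mul_reflection (B : Matrix (Fin r) (Fin r) ℝ) (v w : Fin r → ℝ) :
    v ⬝ᵥ (B * reflection w) *ᵥ v =
      v ⬝ᵥ B *ᵥ v - 2 / (w ⬝ᵥ w) * (w ⬝ᵥ v) * (v ⬝ᵥ B *ᵥ w) := by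
  simp [reflection, Matrix.mul_sub, Matrix.mul_vecMulVec, Matrix.sub_mulVec, Matrix.smul_mulVec,
    Matrix.vecMulVec_mulVec, dotProduct_sub, dotProduct_smul]
  ring

/-- A square matrix whose trace cannot be increased by an orthogonal factor is symmetric and
positive semidefinite.  It is enough to test against reflections and products of two of them. -/
theorem posSemidef_of_trace_mul_le {B : Matrix (Fin r) (Fin r) ℝ}
    (h : ∀ Q : Matrix (Fin r) (Fin r) ℝ, Q * Qᵀ = 1 → (B * Q).trace ≤ B.trace) :
    B.PosSemidef := by
  have hsymm : Bᵀ = B := by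
    ext j i
    rw [Matrix.transpose_apply]
    rcases eq_or_ne i j with rfl | hij
    · rfl
    -- Reflecting first in `eᵢ + t eⱼ` and then in `eᵢ` is a rotation by an angle of order `t`.
    have key : ∀ t : ℝ, t * (B i j - B j i) ≤ t ^ 2 * (B j j + B i i) := by
      intro t
      set v : Fin r → ℝ := Pi.single i 1 with hv
      set w : Fin r → ℝ := Pi.single i 1 + t • Pi.single j 1 with hw
      have hvv : v ⬝ᵥ v = 1 := by simp [hv]
      have hwv : w ⬝ᵥ v = 1 := by simp [hv, hw, hij]
      have hww : w ⬝ᵥ w = 1 + t ^ 2 := by simp [hw, hij.symm, hij]; ring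
      have hv0 : v ≠ 0 := by intro h0; simp [h0] at hvv
      have hw0 : w ≠ 0 := by intro h0; simp [h0] at hwv
      have hQ := h (reflection w * reflection v) (by
        rw [Matrix.transpose_mul, Matrix.mul_assoc, ← Matrix.mul_assoc (reflection v),
          reflection_mul_transpose hv0, Matrix.one_mul, reflection_mul_transpose hw0])
      rw [← Matrix.mul_assoc, trace_mul_reflection, dotProduct_mul_reflection,
        trace_mul_reflection, hvv, hwv, hww] at hQ
      have e1 : v ⬝ᵥ B *ᵥ v = B i i := by simp [hv]
      have e2 : v ⬝ᵥ B *ᵥ w = B i i + t * B i j := by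
        simp [hv, hw, Matrix.mulVec_add, Matrix.mulVec_smul]
      have e3 : w ⬝ᵥ B *ᵥ w = B i i + t * B i j + t * B j i + t ^ 2 * B j j := by
        simp [hw, Matrix.mulVec_add, Matrix.mulVec_smul, mul_add]; ring
      rw [e1, e2, e3] at hQ
      have hp : 0 < 1 + t ^ 2 := by positivity
      have h2 : (1 + t ^ 2) * (2 / (1 + t ^ 2)) = 2 := by field_simp
      have h3 := mul_le_mul_of_nonneg_left hQ hp.le
      linear_combination (1 / 2) * h3 + (1 / 2) * (B i i + t * B i j + t * B j i + t ^ 2 * B j j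
        - 2 * (B i i + t * B i j)) * h2
    -- A linear function of `t` dominated by a quadratic one near `0` vanishes.
    set a := B i j - B j i
    set b := B j j + B i i
    have hzero : a = 0 := by
      by_contra ha
      have ha2 : 0 < a ^ 2 := by positivity
      have h1 := key (a / (|b| + 1))
      have hb : 0 < |b| + 1 := by positivity
      have h2 : (a / (|b| + 1)) ^ 2 * b ≤ (a / (|b| + 1)) ^ 2 * |b| :=
        mul_le_mul_of_nonneg_left (le_abs_self b) (by positivity)
      have h3 : (a / (|b| + 1)) ^ 2 * |b| < a / (|b| + 1) * a := by
        have : a / (|b| + 1) * a - (a / (|b| + 1)) ^ 2 * |b| = a ^ 2 / (|b| + 1) ^ 2 := by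
          field_simp; ring
        have : 0 < a ^ 2 / (|b| + 1) ^ 2 := by positivity
        linarith
      linarith
    linarith [hzero]
  refine Matrix.PosSemidef.of_dotProduct_mulVec_nonneg
    (by simpa [Matrix.IsHermitian] using hsymm) ?_
  intro w
  rcases eq_or_ne w 0 with rfl | hw
  · simp
  have hQ := h (reflection w) (reflection_mul_transpose hw)
  rw [trace_mul_reflection] at hQ
  have hp := dotProduct_self_pos hw
  have h2 : 0 ≤ 2 / (w ⬝ᵥ w) * (w ⬝ᵥ B *ᵥ w) := by linarith
  have h3 : 0 < 2 / (w ⬝ᵥ w) := by positivity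
  simpa using nonneg_of_mul_nonneg_right h2 h3

/-- Among the factors of `W Wᵀ` there is one aligned with `U`: the closest one in Frobenius norm,
equivalently the one with the largest inner product with `U`. -/
theorem exists_aligned_factor (U W : Matrix (Fin d) (Fin r) ℝ) :
    ∃ V : Matrix (Fin d) (Fin r) ℝ, V * Vᵀ = W * Wᵀ ∧ (Uᵀ * V).PosSemidef := by
  set K : Set (Matrix (Fin d) (Fin r) ℝ) := {V | V * Vᵀ = W * Wᵀ} with hK
  have hclosed : IsClosed K := isClosed_eq (by fun_prop) continuous_const
  have hbdd : Bornology.IsBounded K := by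
    refine (Metric.isBounded_closedBall (x := 0) (r := ‖W‖)).subset ?_
    intro V hV
    have h1 : ‖V‖ ^ 2 = ‖W‖ ^ 2 := by
      rw [← frobInner_self, ← frobInner_self, frobInner, frobInner, Matrix.trace_mul_comm,
        show V * Vᵀ = W * Wᵀ from hV, Matrix.trace_mul_comm]
    have h2 : ‖V‖ = ‖W‖ := by
      rwa [sq_eq_sq₀ (norm_nonneg _) (norm_nonneg _)] at h1
    simp [h2]
  have hcomp : IsCompact K := Metric.isCompact_of_isClosed_isBounded hclosed hbdd
  obtain ⟨V, hV, hmax⟩ := hcomp.exists_isMaxOn ⟨W, rfl⟩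
    (f := fun V => (Uᵀ * V).trace) (by fun_prop)
  refine ⟨V, hV, posSemidef_of_trace_mul_le fun Q hQ => ?_⟩
  rw [Matrix.mul_assoc]
  refine hmax (a := V * Q) ?_
  change V * Q * (V * Q)ᵀ = W * Wᵀ
  rw [Matrix.transpose_mul, Matrix.mul_assoc, ← Matrix.mul_assoc Q, hQ, Matrix.one_mul]
  exact hV

theorem frobInner_gram_nonneg {C : Matrix (Fin r) (Fin r) ℝ} (hC : C.PosSemidef)
    (P : Matrix (Fin d) (Fin r) ℝ) : 0 ≤ frobInner C (Pᵀ * P) := by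
  have h := (hC.mul_mul_conjTranspose_same P).trace_nonneg
  have hCt : Cᵀ = C := by simpa [Matrix.IsHermitian] using hC.1
  rw [frobInner, hCt, ← Matrix.mul_assoc, Matrix.trace_mul_comm, ← Matrix.mul_assoc]
  simpa using h

theorem norm_sq_sub_gram (U V : Matrix (Fin d) (Fin r) ℝ) :
    ‖U * Uᵀ - V * Vᵀ‖ ^ 2 = ‖Uᵀ * U‖ ^ 2 - 2 * ‖Uᵀ * V‖ ^ 2 + ‖Vᵀ * V‖ ^ 2 := by
  simp only [← frobInner_self, frobInner_sub_left, frobInner_sub_right, frobInner_mul_transpose]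
  have h : frobInner (Vᵀ * U) (Vᵀ * U) = frobInner (Uᵀ * V) (Uᵀ * V) := by
    rw [← frobInner_transpose]; simp
  rw [h]; ring

theorem gram_sub {U V : Matrix (Fin d) (Fin r) ℝ} (h : (Uᵀ * V).PosSemidef) :
    (U - V)ᵀ * (U - V) = Uᵀ * U + Vᵀ * V - (2 : ℝ) • (Uᵀ * V) := by
  have hCt : Vᵀ * U = Uᵀ * V := by simpa [Matrix.IsHermitian] using h.1
  rw [Matrix.transpose_sub, Matrix.sub_mul, Matrix.mul_sub, Matrix.mul_sub, hCt, two_smul]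
  abel

/-- For aligned factors, `‖Δ Δᵀ‖² ≤ 2 ‖U Uᵀ - V Vᵀ‖²` where `Δ = U - V`. -/
theorem norm_sq_gram_sub_le {U V : Matrix (Fin d) (Fin r) ℝ} (h : (Uᵀ * V).PosSemidef) :
    ‖(U - V) * (U - V)ᵀ‖ ^ 2 ≤ 2 * ‖U * Uᵀ - V * Vᵀ‖ ^ 2 := by
  have h1 := frobInner_gram_nonneg h (U - V)
  have h2 := frobInner_self_nonneg (Uᵀ * U - Vᵀ * V)
  rw [norm_sq_sub_gram, ← frobInner_self, frobInner_mul_transpose]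
  rw [gram_sub h] at h1 ⊢
  simp only [← frobInner_self, frobInner_sub_left, frobInner_sub_right, frobInner_add_left,
    frobInner_add_right, frobInner_smul_left, frobInner_smul_right] at h1 h2 ⊢
  rw [frobInner_comm (Vᵀ * V) (Uᵀ * U)] at *
  rw [frobInner_comm (Uᵀ * V) (Uᵀ * U), frobInner_comm (Uᵀ * V) (Vᵀ * V)] at *
  linarith

/-- For aligned factors, the error of the product controls the error of the factor. -/
theorem norm_sq_mul_sub_transpose_le {U V : Matrix (Fin d) (Fin r) ℝ} (h : (Uᵀ * V).PosSemidef) :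
    4 / 5 * ‖V * (U - V)ᵀ‖ ^ 2 ≤ ‖U * Uᵀ - V * Vᵀ‖ ^ 2 := by
  have h1 := frobInner_gram_nonneg h (U - V)
  have hG := gram_sub h
  rw [norm_sq_sub_gram, ← frobInner_self (V * _), frobInner_mul_transpose]
  set G := (U - V)ᵀ * (U - V)
  have hA : Uᵀ * U = G - Vᵀ * V + (2 : ℝ) • (Uᵀ * V) := by rw [hG]; abel
  set B := Vᵀ * V
  set C := Uᵀ * V
  -- With `H = C - B` one has `‖U Uᵀ - V Vᵀ‖² = ‖G‖² + 2 ‖H‖² + 4 ⟨G, C⟩ - 2 ⟨G, B⟩`. Completing the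
  -- square in `H + t G`, the choice `t = 7 / 10` is just below the critical `1 / √2`.
  have h2 := frobInner_self_nonneg (C - B + (7 / 10 : ℝ) • G)
  have h3 := frobInner_self_nonneg G
  have h4 : frobInner (Vᵀ * V) ((U - V)ᵀ * (U - V)) = frobInner B G := rfl
  rw [hA]
  simp only [← frobInner_self, frobInner_sub_left, frobInner_sub_right, frobInner_add_left,
    frobInner_add_right, frobInner_smul_left, frobInner_smul_right] at h1 h2 ⊢
  rw [frobInner_comm B C, frobInner_comm G C, frobInner_comm G B] at *
  linarith

end Alignment

/-! ### Pointwise minima of smooth families -/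

section Envelope

open Filter Topology

variable {E : Type*} [NormedAddCommGroup E] [NormedSpace ℝ E]

/-- Danskin's theorem: a minimum of a compact family of continuously differentiable functions is
differentiable at `x` if all members of the family that attain the minimum at `x` have the same
derivative there.  The derivative of a member attaining the minimum at `y` tends to the
common derivative as `y → x`: along every ultrafilter the attaining members converge, by
compactness, to a member that attains the minimum at `x`. -/
theorem hasFDerivAt_of_isLeast_family {T : Type*} [TopologicalSpace T] {K : Set T}
    (hK : IsCompact K) {G : T → E → ℝ} {G' : T → E → E →L[ℝ] ℝ}
    (hG : Continuous fun p : T × E => G p.1 p.2)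
    (hG' : ∀ s x, HasFDerivAt (G s) (G' s x) x)
    (hG'c : Continuous fun p : T × E => G' p.1 p.2) {f : E → ℝ}
    (hf : ∀ x, ∃ s ∈ K, f x = G s x) (hle : ∀ x, ∀ s ∈ K, f x ≤ G s x) {x : E}
    {L : E →L[ℝ] ℝ} (hL : ∀ s ∈ K, G s x = f x → G' s x = L) : HasFDerivAt f L x := by
  choose σ hσK hσ using hf
  have hmv : ∀ y, ∃ z ∈ segment ℝ x y, G (σ y) y - G (σ y) x = G' (σ y) z (y - x) := fun y =>
    domain_mvt (fun z _ => (hG' (σ y) z).hasFDerivWithinAt) convex_univ trivial trivial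
  choose ξ hξ hmv using hmv
  have hξt : Tendsto ξ (𝓝 x) (𝓝 x) := by
    rw [tendsto_iff_norm_sub_tendsto_zero]
    have h0 : Tendsto (fun y => ‖y - x‖) (𝓝 x) (𝓝 0) := by
      have : Tendsto (fun y => ‖y - x‖) (𝓝 x) (𝓝 ‖x - x‖) :=
        (continuous_id.sub continuous_const).norm.tendsto x
      simpa using this
    refine squeeze_zero (fun _ => norm_nonneg _) (fun y => ?_) h0
    obtain ⟨t, ht, ht'⟩ : ∃ t ∈ Set.Icc (0 : ℝ) 1, AffineMap.lineMap x y t = ξ y := by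
      have := hξ y
      rwa [segment_eq_image_lineMap] at this
    rw [← ht', AffineMap.lineMap_apply]
    simp only [vsub_eq_sub, vadd_eq_add, add_sub_cancel_right, norm_smul, Real.norm_eq_abs,
      abs_of_nonneg ht.1]
    exact mul_le_of_le_one_left (norm_nonneg _) ht.2
  have hlim : Tendsto (fun y => G' (σ y) (ξ y)) (𝓝 x) (𝓝 L) := by
    rw [tendsto_iff_ultrafilter]
    intro u hu
    obtain ⟨s, hsK, hs⟩ := hK.ultrafilter_le_nhds (u.map σ)
      (le_principal_iff.2 (Filter.mem_map.2 (Filter.univ_mem' hσK)))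
    have hs' : Tendsto σ u (𝓝 s) := hs
    have hux : Tendsto (fun y : E => y) u (𝓝 x) := hu
    have h1 : Tendsto (fun y => G (σ y) y) u (𝓝 (G s x)) :=
      (hG.tendsto (s, x)).comp (hs'.prodMk_nhds hux)
    have hmin : ∀ q ∈ K, G s x ≤ G q x := by
      intro q hq
      have h2 : Tendsto (fun y => G q y) u (𝓝 (G q x)) :=
        (hG.tendsto (q, x)).comp (tendsto_const_nhds.prodMk_nhds hux)
      exact le_of_tendsto_of_tendsto' h1 h2 fun y => (hσ y).symm.trans_le (hle y q hq)
    have hsx : G s x = f x :=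
      le_antisymm ((hmin _ (hσK x)).trans_eq (hσ x).symm) (hle x s hsK)
    rw [← hL s hsK hsx]
    exact (hG'c.tendsto (s, x)).comp (hs'.prodMk_nhds (hξt.mono_left hu))
  have hup := (hG' (σ x) x).isLittleO
  rw [hL _ (hσK x) (hσ x).symm] at hup
  have hlo : (fun y => (G' (σ y) (ξ y) - L) (y - x)) =o[𝓝 x] fun y => y - x := by
    rw [Asymptotics.isLittleO_iff]
    intro c hc
    have := (tendsto_iff_norm_sub_tendsto_zero.1 hlim).eventually (gt_mem_nhds hc)
    filter_upwards [this] with y hy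
    exact (ContinuousLinearMap.le_opNorm _ _).trans
      (mul_le_mul_of_nonneg_right hy.le (norm_nonneg _))
  refine .of_isLittleO ?_
  rw [Asymptotics.isLittleO_iff] at hup hlo ⊢
  intro c hc
  filter_upwards [hup hc, hlo hc] with y h1 h2
  rw [Real.norm_eq_abs, abs_le] at h1 h2 ⊢
  have h3 := hle y _ (hσK x)
  have h4 := hle x _ (hσK y)
  have h5 := hmv y
  have h6 := hσ x
  have h7 := hσ y
  simp only [sub_apply] at h1 h2 ⊢
  constructor <;> linarith [h1.1, h1.2, h2.1, h2.2]

theorem hasDerivAt_line {g : E → ℝ} (hg : ContDiff ℝ 2 g) (x v : E) (t : ℝ) :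
    HasDerivAt (fun t => g (x + t • v)) (fderiv ℝ g (x + t • v) v) t := by
  have hline : HasDerivAt (fun t : ℝ => x + t • v) v t := by
    simpa using ((hasDerivAt_id t).smul_const v).const_add x
  exact ((hg.differentiable (by norm_num)).differentiableAt.hasFDerivAt).comp_hasDerivAt t hline

theorem hasDerivAt_fderiv_line {g : E → ℝ} (hg : ContDiff ℝ 2 g) (x v : E) :
    HasDerivAt (fun t : ℝ => fderiv ℝ g (x + t • v) v) (fderiv ℝ (fderiv ℝ g) x v v) 0 := by
  have hline : HasDerivAt (fun t : ℝ => x + t • v) v 0 := by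
    simpa using ((hasDerivAt_id (0 : ℝ)).smul_const v).const_add x
  have hd : Differentiable ℝ (fderiv ℝ g) :=
    (hg.fderiv_right (m := 1) (by norm_num)).differentiable (by norm_num)
  have h3 := (hd (x + (0 : ℝ) • v)).hasFDerivAt.comp_hasDerivAt 0 hline
  have h4 := ((ContinuousLinearMap.apply ℝ ℝ v).hasFDerivAt.comp_hasDerivAt (0 : ℝ) h3)
  rw [zero_smul, add_zero] at h4
  exact h4

/-- First and second derivatives of a smooth function, read off along a line. -/
theorem fderiv_line {g : E → ℝ} (hg : ContDiff ℝ 2 g) {x v : E} {p : ℝ → ℝ} {q : ℝ}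
    (hp : ∀ t : ℝ, HasDerivAt (fun t => g (x + t • v)) (p t) t) (hq : HasDerivAt p q 0) :
    fderiv ℝ g x v = p 0 ∧ fderiv ℝ (fderiv ℝ g) x v v = q := by
  have h1 : p = fun t : ℝ => fderiv ℝ g (x + t • v) v :=
    funext fun t => (hp t).unique (hasDerivAt_line hg x v t)
  refine ⟨by simp [h1], ?_⟩
  rw [h1] at hq
  exact (hasDerivAt_fderiv_line hg x v).unique hq

/-- If two smooth majorants of `f` touch `f` at `x` with different derivatives, then `f` has a
concave kink at `x`, and some smooth function squeezed above it has an arbitrarily negative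
Hessian eigenvalue: with `w = g₁ - g₂`, the function `(g₁ + g₂) / 2 - k w² / (1 + k² w²)` lies above
`min g₁ g₂ = (g₁ + g₂) / 2 - |w| / 2`. -/
theorem exists_majorant_of_fderiv_ne {f g₁ g₂ : E → ℝ} (h₁ : ContDiff ℝ ∞ g₁)
    (h₂ : ContDiff ℝ ∞ g₂) (hf₁ : ∀ y, f y ≤ g₁ y) (hf₂ : ∀ y, f y ≤ g₂ y) {x : E}
    (hx₁ : g₁ x = f x) (hx₂ : g₂ x = f x) (hne : fderiv ℝ g₁ x ≠ fderiv ℝ g₂ x) (b : ℝ) :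
    ∃ g : E → ℝ, ContDiff ℝ ∞ g ∧ (∀ y, f y ≤ g y) ∧ g x = f x ∧ HessianMinEigLE g x b := by
  obtain ⟨v, hv⟩ : ∃ v, fderiv ℝ g₁ x v ≠ fderiv ℝ g₂ x v := by
    by_contra! hcon
    exact hne (ContinuousLinearMap.ext hcon)
  have hv0 : v ≠ 0 := by rintro rfl; simp at hv
  have two : ∀ {g : E → ℝ}, ContDiff ℝ ∞ g → ContDiff ℝ 2 g := fun hg => by
    exact_mod_cast contDiff_infty.1 hg 2
  set w : E → ℝ := fun y => g₁ y - g₂ y with hw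
  have hwc : ContDiff ℝ ∞ w := h₁.sub h₂
  have hwx : w x = 0 := by simp [hw, hx₁, hx₂]
  have hw' : fderiv ℝ w x v ≠ 0 := by
    have : fderiv ℝ w x = fderiv ℝ g₁ x - fderiv ℝ g₂ x :=
      fderiv_sub (h₁.differentiable (by norm_num)).differentiableAt
        (h₂.differentiable (by norm_num)).differentiableAt
    rw [this]
    simpa [sub_eq_zero] using hv
  set a := fderiv ℝ w x v with ha
  set m := (fderiv ℝ (fderiv ℝ g₁) x v v + fderiv ℝ (fderiv ℝ g₂) x v v) / 2 with hm
  obtain ⟨k, hk⟩ : ∃ k : ℝ, m - b * ‖v‖ ^ 2 ≤ k * (2 * a ^ 2) :=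
    ⟨(m - b * ‖v‖ ^ 2) / (2 * a ^ 2), by
      rw [div_mul_cancel₀]; positivity⟩
  have hpos : ∀ s : ℝ, 0 < 1 + k ^ 2 * s ^ 2 := fun s => by positivity
  set g : E → ℝ := fun y => (g₁ y + g₂ y) / 2 - k * w y ^ 2 / (1 + k ^ 2 * w y ^ 2) with hg
  have hgc : ContDiff ℝ ∞ g :=
    ((h₁.add h₂).div_const 2).sub ((contDiff_const.mul (hwc.pow 2)).div
      (contDiff_const.add (contDiff_const.mul (hwc.pow 2))) fun y => (hpos _).ne')
  refine ⟨g, hgc, fun y => ?_, by simp [hg, hwx, hx₁, hx₂], v, hv0, ?_⟩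
  · have hb : k * w y ^ 2 / (1 + k ^ 2 * w y ^ 2) ≤ |w y| / 2 := by
      rw [div_le_iff₀ (hpos _)]
      have h1 : k * |w y| ≤ (1 + k ^ 2 * |w y| ^ 2) / 2 := by nlinarith [sq_nonneg (k * |w y| - 1)]
      have h2 := mul_le_mul_of_nonneg_left h1 (abs_nonneg (w y))
      rw [← sq_abs (w y)]
      linarith
    have h3 : |w y| / 2 ≤ (g₁ y + g₂ y) / 2 - f y := by
      rcases abs_cases (w y) with ⟨h, _⟩ | ⟨h, _⟩ <;> rw [h] <;> simp only [hw] <;>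
        linarith [hf₁ y, hf₂ y]
    simp only [hg]
    linarith
  · have d₁ := hasDerivAt_line (two h₁) x v
    have d₂ := hasDerivAt_line (two h₂) x v
    have dw := hasDerivAt_line (two hwc) x v
    have e₁ := hasDerivAt_fderiv_line (two h₁) x v
    have e₂ := hasDerivAt_fderiv_line (two h₂) x v
    have ew := hasDerivAt_fderiv_line (two hwc) x v
    have hp : ∀ t : ℝ, HasDerivAt (fun t => g (x + t • v))
        ((fderiv ℝ g₁ (x + t • v) v + fderiv ℝ g₂ (x + t • v) v) / 2
          - 2 * k * w (x + t • v) / (1 + k ^ 2 * w (x + t • v) ^ 2) ^ 2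
            * fderiv ℝ w (x + t • v) v) t := by
      intro t
      have := (((d₁ t).add (d₂ t)).div_const 2).sub ((((dw t).pow 2).const_mul k).div
        ((((dw t).pow 2).const_mul (k ^ 2)).const_add 1) (hpos _).ne')
      refine this.congr_deriv ?_
      have hne := (hpos (w (x + t • v))).ne'
      simp only [Pi.pow_apply]
      field_simp
      ring
    have hq := ((e₁.add e₂).div_const 2).sub
      ((((dw 0).const_mul (2 * k)).div
        (((((dw 0).pow 2).const_mul (k ^ 2)).const_add 1).pow 2)
        (by have := hpos (w (x + (0 : ℝ) • v)); simp only [Pi.pow_apply]; positivity)).mul ew)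
    have hfin := (fderiv_line (two hgc) hp hq).2
    rw [hfin]
    simp only [Pi.pow_apply, zero_smul, add_zero, hwx, Pi.div_apply]
    norm_num
    simp only [← ha]
    linarith [hk]

/-- The value at `v` of the derivative of `g` at `x`. -/
def derivAlong (g : E → ℝ) (x v : E) : ℝ := fderiv ℝ g x v

/-- The value at `v` of the Hessian quadratic form of `g` at `x`. -/
def curvatureAlong (g : E → ℝ) (x v : E) : ℝ := fderiv ℝ (fderiv ℝ g) x v v

theorem contDiff_two {g : E → ℝ} (hg : ContDiff ℝ ∞ g) : ContDiff ℝ 2 g := by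
  exact_mod_cast contDiff_infty.1 hg 2

theorem derivAlong_eq_of_hasDerivAt {g : E → ℝ} (hg : ContDiff ℝ ∞ g) {x v : E} {p : ℝ → ℝ}
    {q : ℝ}
    (hp : ∀ t : ℝ, HasDerivAt (fun t => g (x + t • v)) (p t) t) (hq : HasDerivAt p q 0) :
    derivAlong g x v = p 0 ∧ curvatureAlong g x v = q :=
  fderiv_line (contDiff_two hg) hp hq

/-- A local minimum of `f` is a critical point with nonnegative curvature of every smooth majorant
that touches `f` there. -/
theorem derivAlong_eq_zero_of_isLocalMin {f g : E → ℝ} (hg : ContDiff ℝ ∞ g) {x : E}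
    (hf : ∀ y, f y ≤ g y) (hx : g x = f x) (hmin : IsLocalMin f x) (v : E) :
    derivAlong g x v = 0 ∧ 0 ≤ curvatureAlong g x v := by
  have hgmin : IsLocalMin g x := by
    filter_upwards [hmin] with y hy
    exact hx.trans_le (hy.trans (hf y))
  refine ⟨by rw [derivAlong, hgmin.fderiv_eq_zero]; rfl, ?_⟩
  by_contra! hneg
  have h2 := hasDerivAt_fderiv_line (contDiff_two hg) x v
  set φ : ℝ → ℝ := fun t => g (x + t • v) with hφ
  have hφ' : deriv φ = fun t : ℝ => fderiv ℝ g (x + t • v) v :=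
    funext fun t => (hasDerivAt_line (contDiff_two hg) x v t).deriv
  have hφ0 : deriv φ 0 = 0 := by
    rw [hφ']
    simp [hgmin.fderiv_eq_zero]
  have hφ2 : deriv (deriv φ) 0 < 0 := by
    rw [hφ', h2.deriv]
    exact hneg
  have hφc : ContinuousAt φ 0 := (hasDerivAt_line (contDiff_two hg) x v 0).continuousAt
  have hmax : IsLocalMax φ 0 := isLocalMax_of_deriv_deriv_neg hφ2 hφ0 hφc
  have hlmin : IsLocalMin φ 0 := by
    have hc : ContinuousAt (fun t : ℝ => x + t • v) 0 := by fun_prop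
    have : Tendsto (fun t : ℝ => x + t • v) (𝓝 0) (𝓝 x) := by simpa [ContinuousAt] using hc
    filter_upwards [this.eventually hgmin] with t ht
    simpa [hφ] using ht
  -- A function with a local minimum and a local maximum at `0` is constant near `0`.
  have hconst : φ =ᶠ[𝓝 0] fun _ => φ 0 := by
    filter_upwards [hmax, hlmin] with t h3 h4
    exact le_antisymm h3 h4
  have h3 : deriv φ =ᶠ[𝓝 0] deriv fun _ => φ 0 := hconst.deriv
  have h4 := h3.deriv_eq
  simp at h4
  linarith

/-- A minimum of a compact smooth family is pseudo strict saddle if every approximate second-order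
critical point of a member attaining the minimum lies near a local minimum. -/
theorem isPseudoStrictSaddle_of_family {T : Type*} [NormedAddCommGroup T] [NormedSpace ℝ T]
    {K : Set T} (hK : IsCompact K) {G : T → E → ℝ}
    (hG : ContDiff ℝ ∞ fun p : T × E => G p.1 p.2) {f : E → ℝ}
    (hf : ∀ x, ∃ s ∈ K, f x = G s x) (hle : ∀ x, ∀ s ∈ K, f x ≤ G s x) {θ η ζ : ℝ}
    (h : ∀ x, ∀ s ∈ K, G s x = f x → (∀ v, |derivAlong (G s) x v| ≤ θ * ‖v‖) →
      (∀ v, -η * ‖v‖ ^ 2 ≤ curvatureAlong (G s) x v) → ∃ y, IsLocalMin f y ∧ ‖x - y‖ ≤ ζ) :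
    IsPseudoStrictSaddle f θ η ζ := by
  have hGs : ∀ s, ContDiff ℝ ∞ (G s) := fun s =>
    hG.comp (contDiff_const.prodMk contDiff_id)
  have hd : ∀ s x, HasFDerivAt (G s) (fderiv ℝ (G s) x) x := fun s x =>
    ((hGs s).differentiable (by norm_num)).differentiableAt.hasFDerivAt
  intro x
  obtain ⟨s, hs, hsx⟩ := hf x
  by_cases hsame : ∀ q ∈ K, G q x = f x → fderiv ℝ (G q) x = fderiv ℝ (G s) x
  · have hfd : HasFDerivAt f (fderiv ℝ (G s) x) x := by
      refine hasFDerivAt_of_isLeast_family hK (G' := fun q y => fderiv ℝ (G q) y)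
        hG.continuous hd ?_ hf hle hsame
      have := ContDiff.fderiv (𝕜 := ℝ) (n := 0) (m := ∞)
        (f := fun (p : T × E) (y : E) => G p.1 y) (g := fun p => p.2)
        (hG.comp ((contDiff_fst.comp contDiff_fst).prodMk contDiff_snd)) contDiff_snd
        (by norm_num)
      exact this.continuous
    by_cases hθ : θ ≤ ‖fderiv ℝ f x‖
    · exact Or.inl ⟨hfd.differentiableAt, hθ⟩
    right
    rw [hfd.fderiv, not_le] at hθ
    by_cases hη : ∀ v, -η * ‖v‖ ^ 2 ≤ curvatureAlong (G s) x v
    · right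
      refine h x s hs hsx.symm (fun v => ?_) hη
      exact ((fderiv ℝ (G s) x).le_opNorm v).trans
        (mul_le_mul_of_nonneg_right hθ.le (norm_nonneg v))
    · left
      push Not at hη
      obtain ⟨v, hv⟩ := hη
      refine ⟨G s, hGs s, fun y => hle y s hs, hsx.symm, v, ?_, hv.le⟩
      rintro rfl
      simp [curvatureAlong] at hv
  · right; left
    push Not at hsame
    obtain ⟨q, hq, hqx, hne⟩ := hsame
    exact exists_majorant_of_fderiv_ne (hGs q) (hGs s) (fun y => hle y q hq)
      (fun y => hle y s hs) hqx hsx.symm hne (-η)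

end Envelope

/-! ### The loss for a fixed sparse component -/

section Loss

variable {d r : ℕ}

/-- The smooth function `½ ‖U Uᵀ + S - Mₒ‖_F²` of `U`, whose minimum over `S` is the objective. -/
def loss (Mo S : Matrix (Fin d) (Fin d) ℝ) (U : Matrix (Fin d) (Fin r) ℝ) : ℝ :=
  1 / 2 * ‖U * Uᵀ + S - Mo‖ ^ 2

theorem contDiff_linearMap {E : Type*} [NormedAddCommGroup E] [NormedSpace ℝ E]
    [FiniteDimensional ℝ E] (φ : E →ₗ[ℝ] ℝ) : ContDiff ℝ ∞ φ :=
  φ.toContinuousLinearMap.contDiff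

theorem contDiff_entry {m n : Type*} [Fintype m] [Fintype n] (i : m) (j : n) :
    ContDiff ℝ ∞ fun A : Matrix m n ℝ => A i j :=
  contDiff_linearMap (Matrix.entryLinearMap ℝ ℝ i j)

theorem contDiff_loss_uncurried (Mo : Matrix (Fin d) (Fin d) ℝ) :
    ContDiff ℝ ∞ fun p : Matrix (Fin d) (Fin d) ℝ × Matrix (Fin d) (Fin r) ℝ =>
      loss Mo p.1 p.2 := by
  simp only [loss, ← frobInner_self, frobInner_eq_sum, Matrix.sub_apply, Matrix.add_apply,
    Matrix.mul_apply, Matrix.transpose_apply]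
  have h1 : ∀ i j, ContDiff ℝ ∞ fun p : Matrix (Fin d) (Fin d) ℝ × Matrix (Fin d) (Fin r) ℝ =>
      p.1 i j := fun i j => (contDiff_entry i j).comp contDiff_fst
  have h2 : ∀ i j, ContDiff ℝ ∞ fun p : Matrix (Fin d) (Fin d) ℝ × Matrix (Fin d) (Fin r) ℝ =>
      p.2 i j := fun i j => (contDiff_entry i j).comp contDiff_snd
  have h3 : ∀ i j, ContDiff ℝ ∞ fun p : Matrix (Fin d) (Fin d) ℝ × Matrix (Fin d) (Fin r) ℝ =>
      (∑ k, p.2 i k * p.2 j k) + p.1 i j - Mo i j := fun i j =>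
    ((ContDiff.sum fun k _ => (h2 i k).mul (h2 j k)).add (h1 i j)).sub contDiff_const
  exact contDiff_const.mul (ContDiff.sum fun i _ => ContDiff.sum fun j _ => (h3 i j).mul (h3 i j))

theorem contDiff_loss (Mo S : Matrix (Fin d) (Fin d) ℝ) :
    ContDiff ℝ ∞ (loss Mo S : Matrix (Fin d) (Fin r) ℝ → ℝ) :=
  ContDiff.comp (g := fun p : Matrix (Fin d) (Fin d) ℝ × Matrix (Fin d) (Fin r) ℝ =>
    loss Mo p.1 p.2) (f := fun U => (S, U)) (contDiff_loss_uncurried Mo)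
      (contDiff_const.prodMk contDiff_id)

theorem derivAlong_curvature_loss (Mo S : Matrix (Fin d) (Fin d) ℝ)
    (U V : Matrix (Fin d) (Fin r) ℝ) :
    derivAlong (loss Mo S) U V = frobInner (U * Uᵀ + S - Mo) (U * Vᵀ + V * Uᵀ) ∧
    curvatureAlong (loss Mo S) U V =
      ‖U * Vᵀ + V * Uᵀ‖ ^ 2 + 2 * frobInner (U * Uᵀ + S - Mo) (V * Vᵀ) := by
  set A := U * Uᵀ + S - Mo with hA
  set L := U * Vᵀ + V * Uᵀ with hL
  set Q := V * Vᵀ with hQ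
  have hexp : ∀ t : ℝ, loss Mo S (U + t • V) =
      1 / 2 * frobInner A A + frobInner A L * t + (1 / 2 * frobInner L L + frobInner A Q) * t ^ 2 +
        frobInner L Q * t ^ 3 + 1 / 2 * frobInner Q Q * t ^ 4 := by
    intro t
    have h1 : (U + t • V) * (U + t • V)ᵀ + S - Mo = A + t • L + (t ^ 2) • Q := by
      simp only [hA, hL, hQ, Matrix.transpose_add, Matrix.transpose_smul, Matrix.add_mul,
        Matrix.mul_add, Matrix.smul_mul, Matrix.mul_smul, smul_add, smul_smul, sq]
      abel
    rw [loss, h1, ← frobInner_self]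
    simp only [frobInner_add_left, frobInner_add_right, frobInner_smul_left, frobInner_smul_right]
    rw [frobInner_comm L A, frobInner_comm Q A, frobInner_comm Q L]
    ring
  have hp : ∀ t : ℝ, HasDerivAt (fun t : ℝ => loss Mo S (U + t • V))
      (frobInner A L + (1 / 2 * frobInner L L + frobInner A Q) * (2 * t) +
        frobInner L Q * (3 * t ^ 2) + 1 / 2 * frobInner Q Q * (4 * t ^ 3)) t := by
    intro t
    simp only [hexp]
    have := (((((hasDerivAt_id t).const_mul (frobInner A L)).const_add
      (1 / 2 * frobInner A A)).add ((hasDerivAt_pow 2 t).const_mul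
        (1 / 2 * frobInner L L + frobInner A Q))).add
          ((hasDerivAt_pow 3 t).const_mul (frobInner L Q))).add
            ((hasDerivAt_pow 4 t).const_mul (1 / 2 * frobInner Q Q))
    refine this.congr_deriv ?_
    norm_num
  have hq : HasDerivAt (fun t : ℝ => frobInner A L +
      (1 / 2 * frobInner L L + frobInner A Q) * (2 * t) +
        frobInner L Q * (3 * t ^ 2) + 1 / 2 * frobInner Q Q * (4 * t ^ 3))
      (frobInner L L + 2 * frobInner A Q) 0 := by
    have := (((((hasDerivAt_id (0 : ℝ)).const_mul 2).const_mul
      (1 / 2 * frobInner L L + frobInner A Q)).const_add (frobInner A L)).add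
        (((hasDerivAt_pow 2 (0 : ℝ)).const_mul 3).const_mul (frobInner L Q))).add
          (((hasDerivAt_pow 3 (0 : ℝ)).const_mul 4).const_mul (1 / 2 * frobInner Q Q))
    refine this.congr_deriv ?_
    norm_num
    ring
  obtain ⟨e1, e2⟩ := derivAlong_eq_of_hasDerivAt (contDiff_loss Mo S) hp hq
  refine ⟨by simpa using e1, ?_⟩
  rw [e2, frobInner_self]

end Loss

/-! ### Spectral form of an incoherent positive semidefinite matrix -/

section Spectral

variable {d r : ℕ}

/-- If `M Mᵀ` has the eigenvector `x` for the eigenvalue `s²`, `s > 0`, and `M` is positive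
semidefinite, then `M x = s x`: the vector `y = M x - s x` satisfies `M y = - s y`. -/
theorem mulVec_eq_smul_of_sq {M : Matrix (Fin d) (Fin d) ℝ} (hM : M.PosSemidef) {s : ℝ}
    (hs : 0 < s) {x : Fin d → ℝ} (hx : M *ᵥ M *ᵥ x = s ^ 2 • x) : M *ᵥ x = s • x := by
  set y := M *ᵥ x - s • x with hy
  have h1 : M *ᵥ y = -s • y := by
    rw [hy, Matrix.mulVec_sub, Matrix.mulVec_smul, hx, smul_sub, smul_smul]
    module
  have h2 := hM.dotProduct_mulVec_nonneg y
  rw [h1] at h2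
  simp only [star_trivial, dotProduct_smul, smul_eq_mul] at h2
  have h3 : y = 0 := by
    by_contra hne
    have := dotProduct_self_pos hne
    nlinarith
  exact sub_eq_zero.1 h3

/-- A positive number `s` whose square is an eigenvalue of `Mᵀ M` is one of the `rank M` nonzero
singular values. -/
theorem singularValue_bounds {M : Matrix (Fin d) (Fin d) ℝ} (hrank : M.rank = r) {s : ℝ}
    (hs : 0 < s) {x : Fin d → ℝ} (hx0 : x ≠ 0) (hx : Mᵀ *ᵥ M *ᵥ x = s ^ 2 • x) :
    sigma M r ≤ s ∧ s ≤ sigma M 1 := by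
  set T := Matrix.toEuclideanLin M with hT
  have heig : Module.End.HasEigenvalue (LinearMap.adjoint T ∘ₗ T) (s ^ 2) := by
    refine Module.End.hasEigenvalue_of_hasEigenvector (x := WithLp.toLp 2 x) ⟨?_, ?_⟩
    · rw [Module.End.mem_eigenspace_iff, LinearMap.comp_apply, hT,
        ← Matrix.toEuclideanLin_conjTranspose_eq_adjoint]
      simp only [Matrix.toLpLin_toLp, Matrix.conjTranspose_eq_transpose_of_trivial,
        Matrix.toLin'_apply, hx, WithLp.toLp_smul]
    · simpa using hx0
  have hfr : Module.finrank ℝ (EuclideanSpace ℝ (Fin d)) = d := by simp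
  obtain ⟨j, hj⟩ := T.isSymmetric_adjoint_comp_self.exists_eigenvalues_eq hfr heig
  have hsj : T.singularValues j = s := by
    rw [T.singularValues_fin hfr j]
    have : T.isSymmetric_adjoint_comp_self.eigenvalues hfr j = s ^ 2 := by exact_mod_cast hj
    rw [this, Real.sqrt_sq hs.le]
  have hrange : Module.finrank ℝ T.range = r := by
    rw [← hrank, hT, Matrix.toEuclideanLin_eq_toLin_orthonormal,
      ← Matrix.rank_eq_finrank_range_toLin]
  have hjr : (j : ℕ) < r := by
    rw [← hrange, ← T.singularValues_pos_iff_lt_finrank_range, hsj]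
    exact hs
  rw [← hsj]
  exact ⟨T.singularValues_antitone (by omega), T.singularValues_antitone (by simp)⟩

theorem sigma_rank_pos {M : Matrix (Fin d) (Fin d) ℝ} (hrank : M.rank = r) (hr : 1 ≤ r) :
    0 < sigma M r := by
  rw [sigma, LinearMap.singularValues_pos_iff_lt_finrank_range,
    Matrix.toEuclideanLin_eq_toLin_orthonormal, ← Matrix.rank_eq_finrank_range_toLin, hrank]
  omega

/-- For a positive semidefinite `M`, the left singular vectors of an incoherent decomposition
diagonalize `M`, with the singular values as eigenvalues. -/
theorem exists_spectral_decomposition {M : Matrix (Fin d) (Fin d) ℝ} {μ : ℝ} (hr : 1 ≤ r)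
    (hM : M.PosSemidef) (hrank : M.rank = r) (hinc : IsIncoherent μ r M) :
    ∃ (X : Matrix (Fin d) (Fin r) ℝ) (s : Fin r → ℝ), Xᵀ * X = 1 ∧
      M = X * Matrix.diagonal s * Xᵀ ∧ (∀ k, sigma M r ≤ s k ∧ s k ≤ sigma M 1) ∧
      (∀ i, X i ⬝ᵥ X i ≤ μ * r / d) ∧ 1 ≤ μ * r := by
  obtain ⟨X, Y, s, hX, hY, hs, hMe, hXi, -⟩ := hinc
  have hMt : Mᵀ = M := by simpa [Matrix.IsHermitian] using hM.1
  have hMe' : M = Y * Matrix.diagonal s * Xᵀ := by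
    rw [← hMt, hMe]; simp [Matrix.mul_assoc]
  have hMM : M * M * X = X * Matrix.diagonal fun k => s k ^ 2 := by
    have h1 : M * X = Y * Matrix.diagonal s := by
      rw [hMe', Matrix.mul_assoc, hX, Matrix.mul_one]
    have h2 : M * Y = X * Matrix.diagonal s := by
      rw [hMe, Matrix.mul_assoc, hY, Matrix.mul_one]
    rw [Matrix.mul_assoc, h1, ← Matrix.mul_assoc, h2, Matrix.mul_assoc,
      Matrix.diagonal_mul_diagonal]
    simp only [sq]
  have hcol : ∀ k, M *ᵥ M *ᵥ (fun i => X i k) = s k ^ 2 • fun i => X i k := by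
    intro k
    ext i
    have := congrFun (congrFun hMM i) k
    rw [Matrix.mul_diagonal, Matrix.mul_assoc] at this
    rw [Pi.smul_apply, smul_eq_mul, mul_comm, ← this]
    rfl
  have hMX : M * X = X * Matrix.diagonal s := by
    ext i k
    have := congrFun (mulVec_eq_smul_of_sq hM (hs k) (hcol k)) i
    rw [Matrix.mul_diagonal, mul_comm, ← smul_eq_mul]
    exact this
  have hMX' : M = X * Matrix.diagonal s * Xᵀ := by
    rw [← hMX]
    conv_lhs => rw [hMe']
    conv_rhs => rw [hMe']
    rw [Matrix.mul_assoc, Matrix.mul_assoc, Matrix.mul_assoc, Matrix.mul_assoc,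
      ← Matrix.mul_assoc Xᵀ X, hX, Matrix.one_mul]
  have hcol0 : ∀ k, (fun i => X i k) ≠ 0 := by
    intro k h0
    have h1 := congrFun (congrFun hX k) k
    rw [Matrix.mul_apply] at h1
    have h2 : ∀ i, X i k = 0 := fun i => congrFun h0 i
    simp [h2] at h1
  have hrow : ∀ i, X i ⬝ᵥ X i ≤ √(μ * r / d) ^ 2 := by
    intro i
    have h1 := pow_le_pow_left₀ (norm_nonneg _) (hXi i) 2
    rw [EuclideanSpace.norm_sq_eq] at h1
    simpa [dotProduct, sq] using h1
  -- A negative `μ r / d` has square root `0`, which would force `X = 0`.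
  have hμ : 0 ≤ μ * r / d := by
    by_contra! hneg
    rw [Real.sqrt_eq_zero'.2 hneg.le] at hrow
    have h1 : ∀ i k, X i k = 0 := by
      intro i k
      by_contra hne
      have h2 : X i ≠ 0 := fun h => hne (congrFun h k)
      have := dotProduct_self_pos h2
      have := hrow i
      norm_num at this
      linarith
    exact hcol0 ⟨0, hr⟩ (funext fun i => h1 i _)
  simp only [Real.sq_sqrt hμ] at hrow
  refine ⟨X, s, hX, hMX', fun k => singularValue_bounds hrank (hs k) (hcol0 k) ?_, hrow, ?_⟩
  · rw [hMt]; exact hcol k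
  -- Summing the row bounds gives `r = ‖X‖² ≤ μ r`.
  have h1 : ∑ i, X i ⬝ᵥ X i = r := by
    have h2 : (Xᵀ * X).trace = ∑ i, X i ⬝ᵥ X i := frobInner_eq_sum X X
    rw [← h2, hX]; simp
  have h2 : ∑ i, X i ⬝ᵥ X i ≤ ∑ _i : Fin d, μ * r / d := Finset.sum_le_sum fun i _ => hrow i
  rw [h1] at h2
  simp only [Finset.sum_const, Finset.card_univ, Fintype.card_fin, nsmul_eq_mul] at h2
  have h3 : (1 : ℝ) ≤ r := by exact_mod_cast hr
  rcases Nat.eq_zero_or_pos d with rfl | hd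
  · simp at h2; linarith
  · have : (d : ℝ) ≠ 0 := by positivity
    rw [mul_div_cancel₀ _ this] at h2
    linarith

theorem dotProduct_self_nonneg {ι : Type*} [Fintype ι] (w : ι → ℝ) : 0 ≤ w ⬝ᵥ w :=
  Finset.sum_nonneg fun i _ => mul_self_nonneg (w i)

theorem mulVec_dotProduct_mulVec {m n : Type*} [Fintype m] [Fintype n] (A : Matrix m n ℝ)
    (x : n → ℝ) (y : m → ℝ) : y ⬝ᵥ A *ᵥ x = (Aᵀ *ᵥ y) ⬝ᵥ x := by
  rw [Matrix.dotProduct_mulVec, Matrix.mulVec_transpose]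

theorem dotProduct_sq_le {ι : Type*} [Fintype ι] (x y : ι → ℝ) :
    (x ⬝ᵥ y) ^ 2 ≤ (x ⬝ᵥ x) * (y ⬝ᵥ y) := by
  simpa [dotProduct, sq] using Finset.sum_mul_sq_le_sq_mul_sq Finset.univ x y

/-- Orthonormal columns: the transpose is a contraction. -/
theorem transpose_mulVec_dotProduct_le {X : Matrix (Fin d) (Fin r) ℝ} (hX : Xᵀ * X = 1)
    (u : Fin d → ℝ) : (Xᵀ *ᵥ u) ⬝ᵥ (Xᵀ *ᵥ u) ≤ u ⬝ᵥ u := by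
  set c := Xᵀ *ᵥ u
  have h0 : 0 ≤ (u - X *ᵥ c) ⬝ᵥ (u - X *ᵥ c) := dotProduct_self_nonneg _
  have h1 : u ⬝ᵥ X *ᵥ c = c ⬝ᵥ c := mulVec_dotProduct_mulVec X c u
  have h2 : (X *ᵥ c) ⬝ᵥ (X *ᵥ c) = c ⬝ᵥ c := by
    rw [mulVec_dotProduct_mulVec, Matrix.mulVec_mulVec, hX, Matrix.one_mulVec]
  rw [sub_dotProduct, dotProduct_sub, dotProduct_sub, dotProduct_comm (X *ᵥ c) u, h1, h2] at h0
  linarith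

/-- A square matrix and its transpose have the same smallest singular value: whatever `A` does to
`w`, some `z` is shrunk at least as much by `Aᵀ`. -/
theorem exists_transpose_mulVec_le (A : Matrix (Fin r) (Fin r) ℝ) {w : Fin r → ℝ} (hw : w ≠ 0) :
    ∃ z : Fin r → ℝ, z ≠ 0 ∧
      ((Aᵀ *ᵥ z) ⬝ᵥ (Aᵀ *ᵥ z)) * (w ⬝ᵥ w) ≤ (z ⬝ᵥ z) * ((A *ᵥ w) ⬝ᵥ (A *ᵥ w)) := by
  by_cases hinj : Function.Injective Aᵀ.mulVecLin
  · obtain ⟨z, hz⟩ := LinearMap.injective_iff_surjective.1 hinj w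
    rw [Matrix.mulVecLin_apply] at hz
    refine ⟨z, ?_, ?_⟩
    · rintro rfl
      exact hw (by simpa using hz.symm)
    · have h1 : w ⬝ᵥ w = z ⬝ᵥ A *ᵥ w := by
        rw [mulVec_dotProduct_mulVec, hz]
      rw [hz, ← sq]
      nth_rewrite 1 [h1]
      exact dotProduct_sq_le z (A *ᵥ w)
  · rw [← LinearMap.ker_eq_bot, ← ne_eq, Submodule.ne_bot_iff] at hinj
    obtain ⟨z, hz, hz0⟩ := hinj
    rw [LinearMap.mem_ker, Matrix.mulVecLin_apply] at hz
    refine ⟨z, hz0, ?_⟩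
    rw [hz]
    have h1 := (dotProduct_self_pos hz0).le
    have h2 : 0 ≤ (A *ᵥ w) ⬝ᵥ (A *ᵥ w) := dotProduct_self_nonneg _
    simpa using mul_nonneg h1 h2

theorem diagonal_dotProduct_ge {s : Fin r → ℝ} {a : ℝ} (h : ∀ k, a ≤ s k) (z : Fin r → ℝ) :
    a * (z ⬝ᵥ z) ≤ z ⬝ᵥ Matrix.diagonal s *ᵥ z := by
  rw [dotProduct, dotProduct, Finset.mul_sum]
  refine Finset.sum_le_sum fun k _ => ?_
  rw [Matrix.mulVec_diagonal]
  nlinarith [h k, mul_self_nonneg (z k)]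

/-- Every factor `V` of `X diag(s) Xᵀ` is bounded below by the smallest `s k`. -/
theorem mulVec_dotProduct_ge_of_factor {X V : Matrix (Fin d) (Fin r) ℝ} (hX : Xᵀ * X = 1)
    {s : Fin r → ℝ} (hV : V * Vᵀ = X * Matrix.diagonal s * Xᵀ) {a : ℝ} (ha : ∀ k, a ≤ s k)
    (w : Fin r → ℝ) : a * (w ⬝ᵥ w) ≤ (V *ᵥ w) ⬝ᵥ (V *ᵥ w) := by
  rcases eq_or_ne w 0 with rfl | hw
  · simp
  obtain ⟨z, hz0, hz⟩ := exists_transpose_mulVec_le (Xᵀ * V) hw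
  have h1 : (Xᵀ * V) * (Xᵀ * V)ᵀ = Matrix.diagonal s := by
    rw [Matrix.transpose_mul, Matrix.mul_assoc, ← Matrix.mul_assoc V, Matrix.transpose_transpose,
      hV, Matrix.mul_assoc, Matrix.mul_assoc, hX, Matrix.mul_one,
      ← Matrix.mul_assoc Xᵀ, hX, Matrix.one_mul]
  have h2 : (((Xᵀ * V)ᵀ *ᵥ z) ⬝ᵥ ((Xᵀ * V)ᵀ *ᵥ z)) = z ⬝ᵥ Matrix.diagonal s *ᵥ z := by
    rw [← mulVec_dotProduct_mulVec, Matrix.mulVec_mulVec, h1]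
  have h3 := diagonal_dotProduct_ge ha z
  have h4 : ((Xᵀ * V) *ᵥ w) ⬝ᵥ ((Xᵀ * V) *ᵥ w) ≤ (V *ᵥ w) ⬝ᵥ (V *ᵥ w) := by
    rw [← Matrix.mulVec_mulVec]
    exact transpose_mulVec_dotProduct_le hX _
  have hz1 := dotProduct_self_pos hz0
  have hw1 := dotProduct_self_pos hw
  rw [h2] at hz
  refine le_of_mul_le_mul_left ?_ hz1
  calc (z ⬝ᵥ z) * (a * (w ⬝ᵥ w)) = a * (z ⬝ᵥ z) * (w ⬝ᵥ w) := by ring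
    _ ≤ (z ⬝ᵥ Matrix.diagonal s *ᵥ z) * (w ⬝ᵥ w) := mul_le_mul_of_nonneg_right h3 hw1.le
    _ ≤ _ := hz
    _ ≤ _ := mul_le_mul_of_nonneg_left h4 hz1.le

theorem row_mul_diagonal_mul_transpose (X : Matrix (Fin d) (Fin r) ℝ) (s : Fin r → ℝ) (i : Fin d) :
    (X * Matrix.diagonal s * Xᵀ) i = X *ᵥ fun k => s k * X i k := by
  ext j
  simp only [Matrix.mul_apply, Matrix.transpose_apply, Matrix.mulVec,
    dotProduct]
  exact Finset.sum_congr rfl fun k _ => by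
    simp [Matrix.diagonal_apply]; ring

theorem row_dotProduct_le {X : Matrix (Fin d) (Fin r) ℝ} (hX : Xᵀ * X = 1) {s : Fin r → ℝ}
    {a ρ : ℝ} (hs : ∀ k, 0 ≤ s k ∧ s k ≤ a) {i : Fin d} (hρ : X i ⬝ᵥ X i ≤ ρ) :
    (X * Matrix.diagonal s * Xᵀ) i ⬝ᵥ (X * Matrix.diagonal s * Xᵀ) i ≤ a ^ 2 * ρ := by
  rw [row_mul_diagonal_mul_transpose, mulVec_dotProduct_mulVec, Matrix.mulVec_mulVec, hX,
    Matrix.one_mulVec]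
  refine le_trans ?_ (mul_le_mul_of_nonneg_left hρ (sq_nonneg a))
  rw [dotProduct, dotProduct, Finset.mul_sum]
  refine Finset.sum_le_sum fun k _ => ?_
  have h1 : s k ^ 2 ≤ a ^ 2 := pow_le_pow_left₀ (hs k).1 (hs k).2 2
  nlinarith [mul_le_mul_of_nonneg_right h1 (mul_self_nonneg (X i k))]

theorem factor_row_dotProduct_le {X V : Matrix (Fin d) (Fin r) ℝ} {s : Fin r → ℝ}
    (hV : V * Vᵀ = X * Matrix.diagonal s * Xᵀ) {a ρ : ℝ} (ha : 0 ≤ a) (hs : ∀ k, s k ≤ a)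
    {i : Fin d} (hρ : X i ⬝ᵥ X i ≤ ρ) : V i ⬝ᵥ V i ≤ a * ρ := by
  have h1 : V i ⬝ᵥ V i = (X * Matrix.diagonal s * Xᵀ) i i := by rw [← hV]; rfl
  rw [h1, row_mul_diagonal_mul_transpose]
  refine le_trans ?_ (mul_le_mul_of_nonneg_left hρ ha)
  rw [Matrix.mulVec, dotProduct, dotProduct, Finset.mul_sum]
  refine Finset.sum_le_sum fun k _ => ?_
  nlinarith [mul_le_mul_of_nonneg_right (hs k) (mul_self_nonneg (X i k))]

end Spectral

/-! ### Sparse matrices -/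

section Sparse

variable {d : ℕ}

theorem sparseSet_mono {β β' b : ℝ} (h : β ≤ β') : sparseSet d β b ⊆ sparseSet d β' b := by
  rintro S ⟨h1, h2, h3⟩
  have hd : β * d ≤ β' * d := mul_le_mul_of_nonneg_right h (Nat.cast_nonneg d)
  exact ⟨fun i => (h1 i).trans hd, fun j => (h2 j).trans hd, h3⟩

theorem card_filter_sub_ne_zero_le {ι : Type*} [Fintype ι] {x y : ι → ℝ} {a b : ℝ}
    (hx : ((Finset.univ.filter fun j => x j ≠ 0).card : ℝ) ≤ a)
    (hy : ((Finset.univ.filter fun j => y j ≠ 0).card : ℝ) ≤ b) :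
    ((Finset.univ.filter fun j => x j - y j ≠ 0).card : ℝ) ≤ a + b := by
  classical
  have h : (Finset.univ.filter fun j => x j - y j ≠ 0) ⊆
      (Finset.univ.filter fun j => x j ≠ 0) ∪ (Finset.univ.filter fun j => y j ≠ 0) := by
    intro j
    simp only [Finset.mem_filter, Finset.mem_univ, true_and, Finset.mem_union]
    intro hj
    by_contra! hc
    simp [hc.1, hc.2] at hj
  have h1 := (Finset.card_le_card h).trans (Finset.card_union_le _ _)
  have h2 : ((Finset.univ.filter fun j => x j - y j ≠ 0).card : ℝ) ≤
      (Finset.univ.filter fun j => x j ≠ 0).card + (Finset.univ.filter fun j => y j ≠ 0).card := by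
    exact_mod_cast h1
  linarith

theorem sparseSet_sub {β b : ℝ} {S S' : Matrix (Fin d) (Fin d) ℝ} (hS : S ∈ sparseSet d β b)
    (hS' : S' ∈ sparseSet d β b) : S - S' ∈ sparseSet d (2 * β) (2 * b) := by
  obtain ⟨h1, h2, h3⟩ := hS
  obtain ⟨h1', h2', h3'⟩ := hS'
  refine ⟨fun i => ?_, fun j => ?_, fun i j => ?_⟩
  · exact (card_filter_sub_ne_zero_le (h1 i) (h1' i)).trans_eq (by ring)
  · exact (card_filter_sub_ne_zero_le (h2 j) (h2' j)).trans_eq (by ring)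
  · rw [Matrix.sub_apply]
    calc |S i j - S' i j| ≤ |S i j| + |S' i j| := abs_sub _ _
      _ ≤ 2 * b := by linarith [h3 i j, h3' i j]

/-- A sum of terms bounded by `c` that vanish outside the support of `x`. -/
theorem sum_le_card_support_mul {ι : Type*} [Fintype ι] {x : ι → ℝ} {N c : ℝ} (hc : 0 ≤ c)
    (hx : ((Finset.univ.filter fun j => x j ≠ 0).card : ℝ) ≤ N) {g : ι → ℝ}
    (hg : ∀ j, g j ≤ c) (hg0 : ∀ j, x j = 0 → g j = 0) : ∑ j, g j ≤ N * c := by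
  classical
  have h1 : ∑ j, g j = ∑ j ∈ Finset.univ.filter (fun j => x j ≠ 0), g j := by
    rw [Finset.sum_filter]
    refine Finset.sum_congr rfl fun j _ => ?_
    split_ifs with h
    · rfl
    · exact hg0 j (not_not.1 h)
  rw [h1]
  refine (Finset.sum_le_card_nsmul _ _ c fun j _ => hg j).trans ?_
  rw [nsmul_eq_mul]
  exact mul_le_mul_of_nonneg_right hx hc

variable {β b : ℝ} {E : Matrix (Fin d) (Fin d) ℝ}

theorem transpose_mem_sparseSet (hE : E ∈ sparseSet d β b) : Eᵀ ∈ sparseSet d β b :=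
  ⟨hE.2.1, hE.1, fun i j => hE.2.2 j i⟩

theorem row_dotProduct_le_of_mem_sparseSet (hE : E ∈ sparseSet d β b) (i : Fin d) :
    E i ⬝ᵥ E i ≤ β * d * b ^ 2 := by
  refine sum_le_card_support_mul (sq_nonneg b) (hE.1 i) (fun j => ?_) fun j hj => by simp [hj]
  rw [← abs_mul_abs_self, ← sq]
  exact pow_le_pow_left₀ (abs_nonneg _) (hE.2.2 i j) 2

theorem row_sum_abs_le_of_mem_sparseSet (hb : 0 ≤ b) (hE : E ∈ sparseSet d β b) (i : Fin d) :
    ∑ j, |E i j| ≤ β * d * b :=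
  sum_le_card_support_mul hb (hE.1 i) (fun j => hE.2.2 i j) fun j hj => by simp [hj]

/-- The quadratic form of a sparse matrix is bounded by its largest absolute row and column
sums. -/
theorem quadratic_form_le_of_mem_sparseSet (hb : 0 ≤ b) (hE : E ∈ sparseSet d β b)
    (v : Fin d → ℝ) : v ⬝ᵥ E *ᵥ v ≤ β * d * b * (v ⬝ᵥ v) := by
  have h1 : v ⬝ᵥ E *ᵥ v ≤ ∑ i, ∑ j, (|E i j| * (v i * v i) / 2 + |E i j| * (v j * v j) / 2) := by
    simp only [dotProduct, Matrix.mulVec, Finset.mul_sum]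
    refine Finset.sum_le_sum fun i _ => Finset.sum_le_sum fun j _ => ?_
    have h2 : v i * (E i j * v j) ≤ |E i j| * (|v i| * |v j|) := by
      calc v i * (E i j * v j) ≤ |v i * (E i j * v j)| := le_abs_self _
        _ = |E i j| * (|v i| * |v j|) := by rw [abs_mul, abs_mul]; ring
    have h3 : |v i| * |v j| ≤ (v i * v i + v j * v j) / 2 := by
      rw [← abs_mul_abs_self (v i), ← abs_mul_abs_self (v j)]
      nlinarith [sq_nonneg (|v i| - |v j|)]
    nlinarith [mul_le_mul_of_nonneg_left h3 (abs_nonneg (E i j))]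
  have h4 : ∑ i, ∑ j, |E i j| * (v i * v i) / 2 ≤ β * d * b * (v ⬝ᵥ v) / 2 := by
    rw [dotProduct, Finset.mul_sum, Finset.sum_div]
    refine Finset.sum_le_sum fun i _ => ?_
    rw [← Finset.sum_div, ← Finset.sum_mul]
    have := mul_le_mul_of_nonneg_right (row_sum_abs_le_of_mem_sparseSet hb hE i)
      (mul_self_nonneg (v i))
    linarith
  have h5 : ∑ i, ∑ j, |E i j| * (v j * v j) / 2 ≤ β * d * b * (v ⬝ᵥ v) / 2 := by
    rw [Finset.sum_comm, dotProduct, Finset.mul_sum, Finset.sum_div]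
    refine Finset.sum_le_sum fun j _ => ?_
    rw [← Finset.sum_div, ← Finset.sum_mul]
    have := mul_le_mul_of_nonneg_right
      (row_sum_abs_le_of_mem_sparseSet hb (transpose_mem_sparseSet hE) j) (mul_self_nonneg (v j))
    simp only [Matrix.transpose_apply] at this
    linarith
  simp only [Finset.sum_add_distrib] at h1
  linarith

/-- The part of `‖W‖²` carried by the support of a sparse matrix. -/
theorem sum_support_sq_le (hE : E ∈ sparseSet d β b) {W : Matrix (Fin d) (Fin d) ℝ}
    {δ : Fin d → ℝ} {ρ : ℝ} (hρ : 0 ≤ ρ) (hδ : ∀ i, 0 ≤ δ i)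
    (hW : ∀ i j, W i j ^ 2 ≤ ρ * (δ i + δ j)) :
    ∑ i, ∑ j, (if E i j = 0 then 0 else W i j ^ 2) ≤ 2 * (β * d * ρ * ∑ i, δ i) := by
  have h1 : ∑ i, ∑ j, (if E i j = 0 then 0 else W i j ^ 2) ≤
      ∑ i, ∑ j, ((if E i j = 0 then 0 else ρ * δ i) + (if E i j = 0 then 0 else ρ * δ j)) := by
    refine Finset.sum_le_sum fun i _ => Finset.sum_le_sum fun j _ => ?_
    split_ifs
    · simp
    · linarith [hW i j]
  have h2 : ∑ i, ∑ j, (if E i j = 0 then 0 else ρ * δ i) ≤ β * d * ρ * ∑ i, δ i := by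
    rw [Finset.mul_sum]
    refine Finset.sum_le_sum fun i _ => ?_
    refine (sum_le_card_support_mul (mul_nonneg hρ (hδ i)) (hE.1 i) (fun j => ?_)
      fun j hj => by simp [hj]).trans_eq (by ring)
    split_ifs
    · exact mul_nonneg hρ (hδ i)
    · exact le_rfl
  have h3 : ∑ i, ∑ j, (if E i j = 0 then 0 else ρ * δ j) ≤ β * d * ρ * ∑ i, δ i := by
    rw [Finset.sum_comm, Finset.mul_sum]
    refine Finset.sum_le_sum fun j _ => ?_
    refine (sum_le_card_support_mul (mul_nonneg hρ (hδ j)) (hE.2.1 j) (fun i => ?_)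
      fun i hi => by simp [hi]).trans_eq (by ring)
    split_ifs
    · exact mul_nonneg hρ (hδ j)
    · exact le_rfl
  simp only [Finset.sum_add_distrib] at h1
  linarith

/-- Young's inequality for `⟨E, W⟩`, where only the entries of `W` on the support of `E` count. -/
theorem neg_frobInner_le (t : ℝ) (ht : 0 < t) (W : Matrix (Fin d) (Fin d) ℝ) :
    -frobInner E W ≤ t / 2 * frobInner E E +
      1 / (2 * t) * ∑ i, ∑ j, (if E i j = 0 then 0 else W i j ^ 2) := by
  simp only [frobInner_eq_sum, Finset.mul_sum, ← Finset.sum_add_distrib, ← Finset.sum_neg_distrib]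
  refine Finset.sum_le_sum fun i _ => Finset.sum_le_sum fun j _ => ?_
  split_ifs with h
  · simp [h]
  · have h1 : t / 2 * (E i j * E i j) + 1 / (2 * t) * W i j ^ 2 + E i j * W i j =
        (t * E i j + W i j) ^ 2 / (2 * t) := by field_simp; ring
    have h2 : 0 ≤ (t * E i j + W i j) ^ 2 / (2 * t) := by positivity
    linarith

/-- The sparse error `E` of an optimal sparse component satisfies `‖E‖² + 2⟨E, D⟩ ≤ 0`, where `D` is
the low-rank error.  Hence `E` is controlled by the entries of `D` on its own support, and
so are the terms by which `E` perturbs the landscape. -/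
theorem sparse_error_le (hE : E ∈ sparseSet d β b) {D W : Matrix (Fin d) (Fin d) ℝ}
    (hED : frobInner E E + 2 * frobInner E D ≤ 0) {δ : Fin d → ℝ} {ρ : ℝ} (hρ : 0 ≤ ρ)
    (hδ : ∀ i, 0 ≤ δ i) (hD : ∀ i j, D i j ^ 2 ≤ ρ * (δ i + δ j))
    (hW : ∀ i j, W i j ^ 2 ≤ ρ * (δ i + δ j)) :
    -4 * frobInner E D - 2 * frobInner E W ≤ 30 * (β * d * ρ * ∑ i, δ i) := by
  have h1 := sum_support_sq_le hE hρ hδ hD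
  have h2 := sum_support_sq_le hE hρ hδ hW
  have h3 := neg_frobInner_le (E := E) (1 / 2) (by norm_num) D
  have h4 := neg_frobInner_le (E := E) 1 (by norm_num) D
  have h5 := neg_frobInner_le (E := E) 1 (by norm_num) W
  -- With `q` the mass of `D` on the support of `E`, `h3` gives `‖E‖² ≤ 4 q`.
  norm_num at h3 h4 h5
  linarith

end Sparse

/-! ### Approximate second-order critical points -/

section Critical

variable {d r : ℕ}

theorem frobInner_vecMulVec {m n : Type*} [Fintype m] [Fintype n] (A : Matrix m n ℝ) (u : m → ℝ)
    (v : n → ℝ) : frobInner A (Matrix.vecMulVec u v) = u ⬝ᵥ A *ᵥ v := by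
  simp only [frobInner_eq_sum, Matrix.vecMulVec_apply, dotProduct, Matrix.mulVec, Finset.mul_sum]
  exact Finset.sum_congr rfl fun i _ => Finset.sum_congr rfl fun j _ => by ring

theorem norm_sq_vecMulVec {m n : Type*} [Fintype m] [Fintype n] (u : m → ℝ) (v : n → ℝ) :
    ‖Matrix.vecMulVec u v‖ ^ 2 = (u ⬝ᵥ u) * (v ⬝ᵥ v) := by
  rw [← frobInner_self, frobInner_vecMulVec, Matrix.vecMulVec_mulVec]
  simp [dotProduct_smul, mul_comm]

theorem norm_sq_eq_sum_dotProduct {m n : Type*} [Fintype m] [Fintype n] (A : Matrix m n ℝ) :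
    ‖A‖ ^ 2 = ∑ i, A i ⬝ᵥ A i := by
  rw [← frobInner_self, frobInner_eq_sum]; rfl

/-- At a point of almost nonnegative curvature, `U` is bounded below.  If `‖U w‖` were small, there
would be a vector `v` in the column space of `X` with `‖Uᵀ v‖` just as small, and the loss
would curve down in the direction `v wᵀ`. -/
theorem mulVec_dotProduct_ge_of_curvature {U X : Matrix (Fin d) (Fin r) ℝ}
    {E : Matrix (Fin d) (Fin d) ℝ} {s : Fin r → ℝ} {σ : ℝ} (hX : Xᵀ * X = 1)
    (hs : ∀ k, σ ≤ s k) (hE : ∀ v : Fin d → ℝ, v ⬝ᵥ E *ᵥ v ≤ σ / 20 * (v ⬝ᵥ v))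
    (hcurv : ∀ V : Matrix (Fin d) (Fin r) ℝ, -(σ / 10) * ‖V‖ ^ 2 ≤ ‖U * Vᵀ + V * Uᵀ‖ ^ 2 +
      2 * frobInner (U * Uᵀ - X * Matrix.diagonal s * Xᵀ + E) (V * Vᵀ)) (w : Fin r → ℝ) :
    σ / 4 * (w ⬝ᵥ w) ≤ (U *ᵥ w) ⬝ᵥ (U *ᵥ w) := by
  rcases eq_or_ne w 0 with rfl | hw
  · simp
  obtain ⟨z, hz0, hz⟩ := exists_transpose_mulVec_le (Xᵀ * U) hw
  set v := X *ᵥ z with hv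
  have hz1 := dotProduct_self_pos hz0
  have hw1 := dotProduct_self_pos hw
  set p := U *ᵥ w with hp
  have hvv : v ⬝ᵥ v = z ⬝ᵥ z := by
    rw [hv, mulVec_dotProduct_mulVec, Matrix.mulVec_mulVec, hX, Matrix.one_mulVec]
  have h1 : (Uᵀ *ᵥ v) ⬝ᵥ (Uᵀ *ᵥ v) * (w ⬝ᵥ w) ≤ (z ⬝ᵥ z) * (p ⬝ᵥ p) := by
    have h2 : (Xᵀ * U)ᵀ *ᵥ z = Uᵀ *ᵥ v := by
      rw [Matrix.transpose_mul, Matrix.transpose_transpose, ← Matrix.mulVec_mulVec]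
    have h3 := transpose_mulVec_dotProduct_le hX p
    rw [h2, ← Matrix.mulVec_mulVec] at hz
    exact hz.trans (mul_le_mul_of_nonneg_left h3 hz1.le)
  have hc := hcurv (Matrix.vecMulVec v w)
  have hVV : Matrix.vecMulVec v w * (Matrix.vecMulVec v w)ᵀ = (w ⬝ᵥ w) • Matrix.vecMulVec v v := by
    rw [Matrix.transpose_vecMulVec, Matrix.vecMulVec_mul_vecMulVec]
    ext i j
    simp [Matrix.vecMulVec_apply]
    ring
  have hUV : U * (Matrix.vecMulVec v w)ᵀ = Matrix.vecMulVec p v := by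
    rw [Matrix.transpose_vecMulVec, Matrix.mul_vecMulVec]
  have hVU : Matrix.vecMulVec v w * Uᵀ = Matrix.vecMulVec v p := by
    rw [← Matrix.transpose_inj, Matrix.transpose_mul, Matrix.transpose_transpose, hUV,
      Matrix.transpose_vecMulVec]
  have hL : ‖Matrix.vecMulVec p v + Matrix.vecMulVec v p‖ ^ 2 ≤ 4 * ((z ⬝ᵥ z) * (p ⬝ᵥ p)) := by
    have h2 := frobInner_self_nonneg (Matrix.vecMulVec p v - Matrix.vecMulVec v p)
    have h3 := norm_sq_vecMulVec p v
    have h4 := norm_sq_vecMulVec v p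
    simp only [← frobInner_self, frobInner_sub_left, frobInner_sub_right, frobInner_add_left,
      frobInner_add_right] at h2 h3 h4 ⊢
    rw [h3, h4, hvv] at h2
    rw [h3, h4, hvv]
    linarith
  have hM : frobInner (X * Matrix.diagonal s * Xᵀ) (Matrix.vecMulVec v v) ≥ σ * (z ⬝ᵥ z) := by
    rw [frobInner_vecMulVec, ← Matrix.mulVec_mulVec, ← Matrix.mulVec_mulVec,
      mulVec_dotProduct_mulVec, hv, Matrix.mulVec_mulVec, hX, Matrix.one_mulVec]
    exact diagonal_dotProduct_ge hs z
  have hUU : frobInner (U * Uᵀ) (Matrix.vecMulVec v v) = (Uᵀ *ᵥ v) ⬝ᵥ (Uᵀ *ᵥ v) := by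
    rw [frobInner_vecMulVec, ← Matrix.mulVec_mulVec, mulVec_dotProduct_mulVec]
  have hEv : frobInner E (Matrix.vecMulVec v v) ≤ σ / 20 * (z ⬝ᵥ z) := by
    rw [frobInner_vecMulVec, ← hvv]
    exact hE v
  rw [hVV, hUV, hVU, norm_sq_vecMulVec, frobInner_smul_right, frobInner_add_left,
    frobInner_sub_left, hUU, hvv] at hc
  refine le_of_mul_le_mul_left ?_ hz1
  have h5 := mul_le_mul_of_nonneg_left hM hw1.le
  have h6 := mul_le_mul_of_nonneg_left hEv hw1.le
  have hpos : 0 ≤ (z ⬝ᵥ z) * (p ⬝ᵥ p) := mul_nonneg hz1.le (dotProduct_self_nonneg p)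
  nlinarith

/-- At an approximate critical point, incoherence of the data passes to `U`: the derivative in the
direction `eᵢ Uᵢᵀ` expresses `‖U Uᵢ‖²` through the `i`-th rows of the data. -/
theorem row_dotProduct_le_of_slope {U : Matrix (Fin d) (Fin r) ℝ} {M E : Matrix (Fin d) (Fin d) ℝ}
    {σ ε m : ℝ} (hσ : 0 < σ) (hMt : Mᵀ = M)
    (hU : ∀ w : Fin r → ℝ, σ / 4 * (w ⬝ᵥ w) ≤ (U *ᵥ w) ⬝ᵥ (U *ᵥ w)) (i : Fin d)
    (hslope : ∀ V : Matrix (Fin d) (Fin r) ℝ,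
      |frobInner (U * Uᵀ - M + E) (U * Vᵀ + V * Uᵀ)| ≤ ε * ‖V‖)
    (hM : M i ⬝ᵥ M i ≤ m) (hE : E i ⬝ᵥ E i ≤ m) (hE' : Eᵀ i ⬝ᵥ Eᵀ i ≤ m) (hεm : ε ^ 2 / σ ≤ m) :
    U i ⬝ᵥ U i ≤ 48 * m / σ := by
  set a := U i with ha
  set u := U *ᵥ a with hu
  have hs := hslope (Matrix.vecMulVec (Pi.single i 1) a)
  have hUV : U * (Matrix.vecMulVec (Pi.single i 1) a)ᵀ = Matrix.vecMulVec u (Pi.single i 1) := by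
    rw [Matrix.transpose_vecMulVec, Matrix.mul_vecMulVec]
  have hVU : Matrix.vecMulVec (Pi.single i 1) a * Uᵀ = Matrix.vecMulVec (Pi.single i 1) u := by
    rw [← Matrix.transpose_inj, Matrix.transpose_mul, Matrix.transpose_transpose, hUV,
      Matrix.transpose_vecMulVec]
  have hnorm : ‖Matrix.vecMulVec (Pi.single i (1 : ℝ)) a‖ ^ 2 = a ⬝ᵥ a := by
    rw [norm_sq_vecMulVec]; simp
  set t := ‖Matrix.vecMulVec (Pi.single i (1 : ℝ)) a‖ with ht
  rw [hUV, hVU] at hs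
  have e1 : ∀ A : Matrix (Fin d) (Fin d) ℝ,
      frobInner A (Matrix.vecMulVec u (Pi.single i 1)) = Aᵀ i ⬝ᵥ u := by
    intro A
    rw [frobInner_vecMulVec, Matrix.mulVec_single_one, dotProduct_comm]
    rfl
  have e2 : ∀ A : Matrix (Fin d) (Fin d) ℝ,
      frobInner A (Matrix.vecMulVec (Pi.single i 1) u) = A i ⬝ᵥ u := by
    intro A
    rw [frobInner_vecMulVec, single_one_dotProduct]
    rfl
  have eU : (U * Uᵀ) i = u := by
    ext j
    simp only [hu, ha, Matrix.mul_apply, Matrix.mulVec, dotProduct, Matrix.transpose_apply]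
    exact Finset.sum_congr rfl fun k _ => mul_comm _ _
  have eUt : (U * Uᵀ)ᵀ = U * Uᵀ := by simp
  simp only [frobInner_add_right, frobInner_add_left, frobInner_sub_left] at hs
  simp only [e1, e2, eUt, hMt, eU] at hs
  -- Young's inequality absorbs the data terms into `u ⬝ᵥ u`.
  have young : ∀ (x : Fin d → ℝ) (c : ℝ), 0 < c →
      x ⬝ᵥ u ≤ c / 2 * (u ⬝ᵥ u) + 1 / (2 * c) * (x ⬝ᵥ x) := by
    intro x c hc
    have h := dotProduct_self_nonneg (x - c • u)
    have h2 : (x - c • u) ⬝ᵥ (x - c • u) = x ⬝ᵥ x - 2 * c * (x ⬝ᵥ u) + c ^ 2 * (u ⬝ᵥ u) := by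
      simp only [sub_dotProduct, dotProduct_sub, smul_dotProduct, dotProduct_smul, smul_eq_mul,
        dotProduct_comm u x]
      ring
    rw [h2] at h
    have h3 : c / 2 * (u ⬝ᵥ u) + 1 / (2 * c) * (x ⬝ᵥ x) - x ⬝ᵥ u =
        (x ⬝ᵥ x - 2 * c * (x ⬝ᵥ u) + c ^ 2 * (u ⬝ᵥ u)) / (2 * c) := by
      field_simp; ring
    have h4 : 0 ≤ (x ⬝ᵥ x - 2 * c * (x ⬝ᵥ u) + c ^ 2 * (u ⬝ᵥ u)) / (2 * c) := by positivity
    linarith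
  have y1 := young (M i) (1 / 2) (by norm_num)
  have y2 := young (-E i) (1 / 2) (by norm_num)
  have y3 := young (-Eᵀ i) (1 / 2) (by norm_num)
  simp only [neg_dotProduct, dotProduct_neg, neg_neg] at y2 y3
  have hua := hU a
  have hεt : ε * t ≤ σ / 8 * t ^ 2 + 2 * (ε ^ 2 / σ) := by
    have h1 : σ / 8 * t ^ 2 + 2 * (ε ^ 2 / σ) - ε * t = (σ * t - 4 * ε) ^ 2 / (8 * σ) := by
      field_simp; ring
    have h2 : 0 ≤ (σ * t - 4 * ε) ^ 2 / (8 * σ) := by positivity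
    linarith
  rw [hnorm] at hεt
  have hs2 := (abs_le.1 hs).2
  norm_num at y1 y2 y3
  rw [le_div_iff₀ hσ]
  linarith

/-- The core estimate: an approximate second-order critical point of the loss for an optimal sparse
component is close to every aligned factor `V` of `M = X diag(s) Xᵀ`. -/
theorem norm_sub_le_of_approx_critical {U V X : Matrix (Fin d) (Fin r) ℝ}
    {E : Matrix (Fin d) (Fin d) ℝ} {s : Fin r → ℝ} {σ a ε ρ R β b : ℝ} (hσ : 0 < σ) (hε : 0 ≤ ε)
    (hX : Xᵀ * X = 1) (hs : ∀ k, σ ≤ s k ∧ s k ≤ a) (hXρ : ∀ i, X i ⬝ᵥ X i ≤ ρ)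
    (hV : V * Vᵀ = X * Matrix.diagonal s * Xᵀ) (hUV : (Uᵀ * V).PosSemidef)
    (hE : E ∈ sparseSet d β b) (hb : 0 ≤ b)
    (hED : frobInner E E + 2 * frobInner E (U * Uᵀ - X * Matrix.diagonal s * Xᵀ) ≤ 0)
    (hcurv : ∀ W : Matrix (Fin d) (Fin r) ℝ, -(σ / 10) * ‖W‖ ^ 2 ≤ ‖U * Wᵀ + W * Uᵀ‖ ^ 2 +
      2 * frobInner (U * Uᵀ - X * Matrix.diagonal s * Xᵀ + E) (W * Wᵀ))
    (hslope : ∀ W : Matrix (Fin d) (Fin r) ℝ,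
      |frobInner (U * Uᵀ - X * Matrix.diagonal s * Xᵀ + E) (U * Wᵀ + W * Uᵀ)| ≤ ε * ‖W‖)
    (hsmall₁ : β * d * b ≤ σ / 20) (hsmall₂ : β * d * b ^ 2 ≤ a ^ 2 * ρ)
    (hεm : ε ^ 2 / σ ≤ a ^ 2 * ρ) (hR : 48 * (a ^ 2 * ρ) / σ ≤ R) (hRV : a * ρ ≤ R)
    (hsmall₃ : 60 * (β * d * R) ≤ σ / 10) :
    ‖U - V‖ ≤ 7 * (ε / σ) := by
  set M := X * Matrix.diagonal s * Xᵀ with hM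
  have hMt : Mᵀ = M := by simp [hM, Matrix.mul_assoc]
  have hlow := mulVec_dotProduct_ge_of_curvature hX (fun k => (hs k).1)
    (fun v => (quadratic_form_le_of_mem_sparseSet hb hE v).trans
      (mul_le_mul_of_nonneg_right hsmall₁ (dotProduct_self_nonneg v))) hcurv
  have hs0 : ∀ k, 0 ≤ s k ∧ s k ≤ a := fun k => ⟨hσ.le.trans (hs k).1, (hs k).2⟩
  have hUR : ∀ i, U i ⬝ᵥ U i ≤ R := fun i =>
    (row_dotProduct_le_of_slope hσ hMt hlow i hslope
      (row_dotProduct_le hX hs0 (hXρ i))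
      ((row_dotProduct_le_of_mem_sparseSet hE i).trans hsmall₂)
      ((row_dotProduct_le_of_mem_sparseSet (transpose_mem_sparseSet hE) i).trans hsmall₂)
      hεm).trans hR
  set Δ := U - V with hΔ
  rcases eq_or_ne Δ 0 with h0 | h0
  · rw [h0, norm_zero]; positivity
  have ha : 0 ≤ a := by
    by_contra! hneg
    have hempty : IsEmpty (Fin r) := ⟨fun k => absurd ((hs0 k).1.trans (hs0 k).2) (not_le.2 hneg)⟩
    exact h0 (Matrix.ext fun i k => hempty.elim k)
  have hVR : ∀ i, V i ⬝ᵥ V i ≤ R := fun i =>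
    (factor_row_dotProduct_le hV ha (fun k => (hs k).2) (hXρ i)).trans hRV
  have hR0 : 0 ≤ R := by
    by_contra! hneg
    have hempty : IsEmpty (Fin d) :=
      ⟨fun i => absurd ((dotProduct_self_nonneg _).trans (hUR i)) (not_le.2 hneg)⟩
    exact h0 (Matrix.ext fun i k => hempty.elim i)
  set D := U * Uᵀ - M with hD
  have hDV : D = U * Uᵀ - V * Vᵀ := by rw [hV]
  -- `D = U Δᵀ + Δ Vᵀ`, so the entries of `D` are controlled by the rows of `U`, `V` and `Δ`.
  have hDe : ∀ i j, D i j = U i ⬝ᵥ Δ j + V j ⬝ᵥ Δ i := by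
    intro i j
    have h1 : D i j = U i ⬝ᵥ U j - V i ⬝ᵥ V j := by rw [hDV]; rfl
    have h2 : ∀ k, Δ k = U k - V k := fun k => rfl
    rw [h1, h2, h2, dotProduct_sub, dotProduct_sub, dotProduct_comm (V j) (U i),
      dotProduct_comm (V j) (V i)]
    ring
  have hΔR : ∀ i, Δ i ⬝ᵥ Δ i ≤ 4 * R := by
    intro i
    have h2 : Δ i = U i - V i := rfl
    have h3 := dotProduct_self_nonneg (U i + V i)
    rw [h2]
    simp only [sub_dotProduct, dotProduct_sub, add_dotProduct, dotProduct_add] at h3 ⊢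
    linarith [hUR i, hVR i]
  have hδ : ∀ i, 0 ≤ Δ i ⬝ᵥ Δ i := fun i => dotProduct_self_nonneg _
  have hDsq : ∀ i j, D i j ^ 2 ≤ 2 * R * (Δ i ⬝ᵥ Δ i + Δ j ⬝ᵥ Δ j) := by
    intro i j
    have h1 := (dotProduct_sq_le (U i) (Δ j)).trans (mul_le_mul_of_nonneg_right (hUR i) (hδ j))
    have h2 := (dotProduct_sq_le (V j) (Δ i)).trans (mul_le_mul_of_nonneg_right (hVR j) (hδ i))
    rw [hDe]
    nlinarith [sq_nonneg (U i ⬝ᵥ Δ j - V j ⬝ᵥ Δ i)]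
  set W := Δ * Δᵀ with hW
  have hWsq : ∀ i j, W i j ^ 2 ≤ 2 * R * (Δ i ⬝ᵥ Δ i + Δ j ⬝ᵥ Δ j) := by
    intro i j
    have h1 : W i j = Δ i ⬝ᵥ Δ j := rfl
    have h2 := dotProduct_sq_le (Δ i) (Δ j)
    have h3 := mul_le_mul_of_nonneg_right (hΔR i) (hδ j)
    have h4 := mul_le_mul_of_nonneg_left (hΔR j) (hδ i)
    rw [h1]
    linarith
  have herr := sparse_error_le hE hED (by positivity : (0 : ℝ) ≤ 2 * R) hδ hDsq hWsq
  rw [← norm_sq_eq_sum_dotProduct] at herr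
  have hsm := mul_le_mul_of_nonneg_right hsmall₃ (sq_nonneg ‖Δ‖)
  have hWD := norm_sq_gram_sub_le hUV
  have hDΔ := norm_sq_mul_sub_transpose_le hUV
  rw [← hDV, ← hΔ] at hWD hDΔ
  have hVΔ : σ * ‖Δ‖ ^ 2 ≤ ‖V * Δᵀ‖ ^ 2 := by
    rw [← Matrix.frobenius_norm_transpose (V * Δᵀ), norm_sq_eq_sum_dotProduct,
      norm_sq_eq_sum_dotProduct, Finset.mul_sum]
    refine Finset.sum_le_sum fun i _ => ?_
    exact mulVec_dotProduct_ge_of_factor hX hV (fun k => (hs k).1) (Δ i)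
  have hlin : U * Δᵀ + Δ * Uᵀ = D + W := by
    rw [hDV, hW, hΔ]
    simp only [Matrix.transpose_sub, Matrix.mul_sub, Matrix.sub_mul]
    abel
  have hc := hcurv Δ
  have hsl := (abs_le.1 (hslope Δ)).2
  rw [hlin] at hc hsl
  simp only [← frobInner_self (D + W), ← frobInner_self D, frobInner_add_left,
    frobInner_add_right, frobInner_comm W D] at hc hsl hWD hDΔ herr
  rw [← hW] at hWD hc
  rw [← frobInner_self W] at hWD
  have hfin : 3 / 5 * σ * ‖Δ‖ ^ 2 ≤ 4 * (ε * ‖Δ‖) := by linarith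
  have hnpos : 0 < ‖Δ‖ := norm_pos_iff.2 h0
  have h7 : 3 / 5 * σ * ‖Δ‖ ≤ 4 * ε := by
    refine le_of_mul_le_mul_right ?_ hnpos
    linarith
  rw [← mul_div_assoc, le_div_iff₀ hσ]
  linarith

end Critical

/-! ### The landscape of the objective -/

section Landscape

variable {d r : ℕ}

theorem exists_factor {X : Matrix (Fin d) (Fin r) ℝ} {s : Fin r → ℝ} (hs : ∀ k, 0 ≤ s k) :
    ∃ W : Matrix (Fin d) (Fin r) ℝ, W * Wᵀ = X * Matrix.diagonal s * Xᵀ := by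
  refine ⟨X * Matrix.diagonal fun k => √(s k), ?_⟩
  rw [Matrix.transpose_mul, Matrix.diagonal_transpose, Matrix.mul_assoc,
    ← Matrix.mul_assoc (Matrix.diagonal _), Matrix.diagonal_mul_diagonal, Matrix.mul_assoc]
  simp only [Real.mul_self_sqrt (hs _)]

/-- Optimality of `S` against the true sparse component `S'`, in terms of the errors. -/
theorem sparse_error_of_loss_le {M S S' : Matrix (Fin d) (Fin d) ℝ} {U : Matrix (Fin d) (Fin r) ℝ}
    (h : loss (M + S') S U ≤ loss (M + S') S' U) :
    frobInner (S - S') (S - S') + 2 * frobInner (S - S') (U * Uᵀ - M) ≤ 0 := by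
  have e1 : U * Uᵀ + S - (M + S') = (S - S') + (U * Uᵀ - M) := by abel
  have e2 : U * Uᵀ + S' - (M + S') = U * Uᵀ - M := by abel
  rw [loss, loss, e1, e2, ← frobInner_self, ← frobInner_self (U * Uᵀ - M)] at h
  generalize S - S' = E at *
  generalize U * Uᵀ - M = D at *
  simp only [frobInner_add_left, frobInner_add_right, frobInner_comm D E] at h
  linarith

/-- The numerical form of the assumption: with `κ = a / σ`, `q` the fraction of nonzero entries and
`m = μ r`, the sparse error is small compared with `σ`, and rows bounded by `R` carry
little mass on its support. -/
theorem sparsity_bounds {a σ q m d : ℝ} (hd : 0 < d) (hσ : 0 < σ) (hσa : σ ≤ a) (hq : 0 ≤ q)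
    (hm : 1 ≤ m) (h : q * m * (a / σ) ^ 5 ≤ 1 / 60000) :
    2 * q * d * (2 * (2 * (m * a / d))) ≤ σ / 20 ∧
    2 * q * d * (2 * (2 * (m * a / d))) ^ 2 ≤ a ^ 2 * (m / d) ∧
    a * (m / d) ≤ 48 * (a ^ 2 * (m / d)) / σ ∧
    60 * (2 * q * d * (48 * (a ^ 2 * (m / d)) / σ)) ≤ σ / 10 := by
  have hκ : 1 ≤ a / σ := (one_le_div hσ).2 hσa
  have ha : 0 < a := hσ.trans_le hσa
  have hκa : a = a / σ * σ := by field_simp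
  set κ := a / σ
  have hqm : 0 ≤ q * m := by positivity
  have k1 : q * m ≤ 1 / 60000 :=
    le_trans (le_mul_of_one_le_right hqm (one_le_pow₀ hκ)) h
  have k2 : q * m * κ ≤ 1 / 60000 :=
    le_trans (mul_le_mul_of_nonneg_left (le_self_pow₀ hκ (by norm_num)) hqm) h
  have k3 : q * m * κ ^ 2 ≤ 1 / 60000 :=
    le_trans (mul_le_mul_of_nonneg_left (pow_le_pow_right₀ hκ (by norm_num)) hqm) h
  refine ⟨?_, ?_, ?_, ?_⟩
  · have e : 2 * q * d * (2 * (2 * (m * a / d))) = 8 * (q * m * κ) * σ := by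
      rw [hκa]; field_simp; ring
    rw [e]
    nlinarith
  · have e : 2 * q * d * (2 * (2 * (m * a / d))) ^ 2 = 32 * (q * m) * (a ^ 2 * (m / d)) := by
      field_simp; ring
    rw [e]
    have : 0 ≤ a ^ 2 * (m / d) := by positivity
    nlinarith
  · rw [le_div_iff₀ hσ]
    have : 0 ≤ a * (m / d) := by positivity
    nlinarith
  · have e : 60 * (2 * q * d * (48 * (a ^ 2 * (m / d)) / σ)) = 5760 * (q * m * κ ^ 2) * σ := by
      rw [hκa]; field_simp; ring
    rw [e]
    nlinarith

theorem sq_div_le_of_le_mul_sqrt {ε σ a m d : ℝ} (hd : 0 < d) (hσ : 0 < σ) (hσa : σ ≤ a)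
    (hm : 1 ≤ m) (hε : 0 ≤ ε) (h : ε ≤ σ * √(σ / d)) : ε ^ 2 / σ ≤ a ^ 2 * (m / d) := by
  have h1 := pow_le_pow_left₀ hε h 2
  rw [mul_pow, Real.sq_sqrt (by positivity)] at h1
  rw [div_le_iff₀ hσ]
  refine h1.trans ?_
  have h2 : σ ^ 2 ≤ a ^ 2 := pow_le_pow_left₀ hσ.le hσa 2
  have h3 : a ^ 2 * (m / d) * σ - σ ^ 2 * (σ / d) = (a ^ 2 * m - σ ^ 2) * (σ / d) := by ring
  have h4 : 0 ≤ (a ^ 2 * m - σ ^ 2) * (σ / d) := by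
    refine mul_nonneg ?_ (by positivity)
    nlinarith [sq_nonneg a]
  linarith

end Landscape

end RobustPCA

end

open RobustPCA in
theorem theorem4p3 :
    ∃ c c₁ c₂ c₃ : ℝ, 0 < c ∧ 0 < c₁ ∧ 0 < c₂ ∧ 0 < c₃ ∧
      ∀ (d r : ℕ) (μ α γ : ℝ) (Mstar Sstar : Matrix (Fin d) (Fin d) ℝ),
        1 ≤ r → Mstar.PosSemidef → Mstar.rank = r →
        RobustPCA.IsIncoherent μ r Mstar →
        Sstar ∈ RobustPCA.sparseSet d α (2 * (μ * r * RobustPCA.sigma Mstar 1 / d)) →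
        c < γ →
        γ * α * (μ * r) * RobustPCA.condNumber Mstar r ^ 5 ≤ 1 / c →
        ∀ f : Matrix (Fin d) (Fin r) ℝ → ℝ,
          f = RobustPCA.objective
            (RobustPCA.sparseSet d (γ * α) (2 * (μ * r * RobustPCA.sigma Mstar 1 / d)))
            (Mstar + Sstar) →
          (∀ U, IsLocalMin f U → U * Uᵀ = Mstar) ∧
          (∀ ε : ℝ, 0 < ε → ε ≤ c₃ * (RobustPCA.sigma Mstar r * √(RobustPCA.sigma Mstar r / d)) →
            RobustPCA.IsPseudoStrictSaddle f ε (c₁ * RobustPCA.sigma Mstar r)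
              (c₂ * (ε * √(RobustPCA.condNumber Mstar r) / RobustPCA.sigma Mstar r))) := by
  -- `60000` makes the sparse error a small multiple of `σᵣ` in each of the `sparsity_bounds`; `1 / 10`
  -- and `7` are the curvature and the distance in `norm_sub_le_of_approx_critical`.
  refine ⟨60000, 1 / 10, 7, 1, by norm_num, by norm_num, by norm_num, by norm_num, ?_⟩
  intro d r μ α γ M S' hr hM hrank hinc hS' hγ hsmall f hf
  obtain ⟨X, s, hX, hMX, hs, hXρ, hμ⟩ := exists_spectral_decomposition hr hM hrank hinc
  have hσ := sigma_rank_pos hrank hr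
  rw [condNumber] at hsmall
  rw [condNumber]
  set σ := sigma M r
  set a := sigma M 1
  have hσa : σ ≤ a := (hs ⟨0, hr⟩).1.trans (hs ⟨0, hr⟩).2
  have ha : 0 < a := hσ.trans_le hσa
  have hdpos : 0 < d := by
    have h1 := M.rank_le_width
    omega
  have hd : (0 : ℝ) < d := by exact_mod_cast hdpos
  have hα : 0 ≤ α := by
    have h1 := (Nat.cast_nonneg _).trans (hS'.1 ⟨0, hdpos⟩)
    exact nonneg_of_mul_nonneg_left h1 hd
  have hq : 0 ≤ γ * α := mul_nonneg (by linarith) hα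
  set b := 2 * (μ * r * a / d) with hb
  have hb0 : 0 ≤ b := by positivity
  have hS'q : S' ∈ sparseSet d (γ * α) b :=
    sparseSet_mono (le_mul_of_one_le_left hα (by linarith)) hS'
  set K := sparseSet d (γ * α) b with hK
  obtain ⟨n1, n2, n3, n4⟩ := sparsity_bounds hd hσ hσa hq hμ hsmall
  have hleast := fun U : Matrix (Fin d) (Fin r) ℝ => isLeast_objective ⟨S', hS'q⟩ (M + S') U
  have hle : ∀ U, ∀ S ∈ K, f U ≤ loss (M + S') S U := fun U S hS => by
    rw [hf]; exact (hleast U).2 ⟨S, hS, rfl⟩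
  have hatt : ∀ U, ∃ S ∈ K, f U = loss (M + S') S U := fun U => by
    obtain ⟨S, hS, h⟩ := (hleast U).1
    exact ⟨S, hS, by rw [hf]; exact h.symm⟩
  have core : ∀ ε : ℝ, 0 ≤ ε → ε ≤ σ * √(σ / d) → ∀ U, ∀ S ∈ K, loss (M + S') S U = f U →
      (∀ V, |derivAlong (loss (M + S') S) U V| ≤ ε * ‖V‖) →
      (∀ V, -(σ / 10) * ‖V‖ ^ 2 ≤ curvatureAlong (loss (M + S') S) U V) →
      ∃ V : Matrix (Fin d) (Fin r) ℝ, V * Vᵀ = M ∧ ‖U - V‖ ≤ 7 * (ε / σ) := by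
    intro ε hε hεle U S hS hSU hslope hcurv
    obtain ⟨W, hW⟩ := exists_factor (X := X) fun k => hσ.le.trans (hs k).1
    obtain ⟨V, hV, hUV⟩ := exists_aligned_factor U W
    rw [hW] at hV
    refine ⟨V, hV.trans hMX.symm, ?_⟩
    have hres : U * Uᵀ + S - (M + S') = U * Uᵀ - X * Matrix.diagonal s * Xᵀ + (S - S') := by
      rw [← hMX]; abel
    simp only [(derivAlong_curvature_loss _ _ _ _).1, (derivAlong_curvature_loss _ _ _ _).2, hres]
      at hslope hcurv
    have hED := sparse_error_of_loss_le (hSU.trans_le (hle U S' hS'q))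
    rw [hMX] at hED
    exact norm_sub_le_of_approx_critical hσ hε hX hs hXρ hV hUV (sparseSet_sub hS hS'q)
      (by positivity) hED hcurv hslope n1 n2 (sq_div_le_of_le_mul_sqrt hd hσ hσa hμ hε hεle)
      le_rfl n3 n4
  constructor
  · -- The core estimate with `ε = 0` puts a local minimum at distance `0` from a factor of `M`.
    intro U hU
    obtain ⟨S, hS, hSU⟩ := hatt U
    have hmin := derivAlong_eq_zero_of_isLocalMin (contDiff_loss (M + S') S) (fun y => hle y S hS)
      hSU.symm hU
    obtain ⟨V, hV, hUV⟩ := core 0 le_rfl (by positivity) U S hS hSU.symm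
      (fun V => by rw [(hmin V).1]; simp)
      (fun V => le_trans (by nlinarith [sq_nonneg ‖V‖]) (hmin V).2)
    have h0 : U - V = 0 := norm_le_zero_iff.1 (by simpa using hUV)
    rw [sub_eq_zero.1 h0, hV]
  · intro ε hε hεle
    refine isPseudoStrictSaddle_of_family (isCompact_sparseSet d (γ * α) b)
      (contDiff_loss_uncurried (M + S')) hatt hle ?_
    intro U S hS hSU hslope hcurv
    obtain ⟨V, hV, hUV⟩ := core ε hε.le (by linarith) U S hS hSU hslope
      (fun V => le_trans (by linarith) (hcurv V))
    refine ⟨V, Filter.Eventually.of_forall fun W => ?_, hUV.trans ?_⟩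
    · -- `V` is a global minimum: with the true sparse component the loss vanishes.
      have h1 : f V ≤ 0 := by
        refine (hle V S' hS'q).trans_eq ?_
        rw [loss, hV, sub_self, norm_zero]
        norm_num
      obtain ⟨T, -, hT⟩ := hatt W
      rw [hT]
      refine h1.trans ?_
      rw [loss]
      positivity
    · have h1 : 1 ≤ √(a / σ) := Real.one_le_sqrt.2 ((one_le_div hσ).2 hσa)
      have h2 : ε ≤ ε * √(a / σ) := le_mul_of_one_le_right hε.le h1
      gcongr
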